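/- Work in ZF (no axiom of choice). A \emph{cardinal in} $On$ is an ordinal (finite or infinite) that is not equinumerous with any smaller ordinal. For $\kappa,\lambda,\mu\in On$ write $\lambda\to(\kappa)^1_\mu$ if every function $f:\lambda\to\mu$ is constant on some set $H\subseteq\lambda$ with $|H|=\kappa$, and write $\lambda\to(\kappa)^2_\mu$ if for every function $c:[\lambda]^2\to\mu$, where $[X]^2$ is the set of two-element subsets of $X$, there is $H\subseteq\lambda$ with $|H|=\kappa$ such that $c$ is constant on $[H]^2$. For a set $X$ let $h(X)$ be the least ordinal $\alpha>0$ such that no function maps $X$ onto $\alpha$. Let $\mu^{<\sigma}$ be the set of all functions from some ordinal $\zeta<\sigma$ to $\mu$. \textbf{Theorem (ZF).} For every cardinal $\kappa\in On$ and every ordinal $\mu$ there is a cardinal $\lambda\in On$ such that $\lambda\to(\kappa)^2_\mu$. More precisely, there is a cardinal $\sigma\in On$ with $\sigma\to(\kappa)^1_\mu$, and for every such cardinal $\sigma$ the ordinal $\lambda=h(\mu^{<\sigma})$ exists, is a cardinal, and satisfies $\lambda\to(\kappa)^2_\mu$. -/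

import Mathlib

open FirstOrder FirstOrder.Language

namespace ZFSetTheory

/-! ### The language of set theory and its formulas -/

/-- The only symbol of the language of set theory: the binary relation symbol of membership. -/
inductive SetRel : ℕ → Type
  | mem : SetRel 2

/-- The first-order language of set theory. -/
def setLang : FirstOrder.Language.{0, 0} := ⟨fun _ => Empty, SetRel⟩

/-- Formulas of set theory with variables indexed by `Fin n`. -/
abbrev Fml (n : ℕ) : Type := setLang.BoundedFormula Empty n

/-- A variable stays available under one more quantifier. -/
@[reducible] def liftVar (n : ℕ) : Coe (Fin n) (Fin (n + 1)) := ⟨Fin.castSucc⟩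

attribute [local instance] liftVar

section Formulas

variable {n : ℕ}

/-- negation -/
def fNot (φ : Fml n) : Fml n := ∼φ

/-- conjunction -/
def fAnd (φ ψ : Fml n) : Fml n := φ ⊓ ψ

/-- disjunction -/
def fOr (φ ψ : Fml n) : Fml n := φ ⊔ ψ

/-- implication -/
def fImp (φ ψ : Fml n) : Fml n := φ ⟹ ψ

/-- equivalence -/
def fIff (φ ψ : Fml n) : Fml n := φ ⇔ ψ

infixr:65 " ⋏ " => fAnd
infixr:64 " ⋎ " => fOr
infixr:63 " ⟶ᶠ " => fImp
infix:62 " ⟷ᶠ " => fIff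

/-- `x ∈ y` -/
def fMem (x y : Fin n) : Fml n :=
  Relations.boundedFormula₂ (L := setLang) SetRel.mem
    (Term.var (Sum.inr x)) (Term.var (Sum.inr y))

/-- `x = y` -/
def fEq (x y : Fin n) : Fml n :=
  Term.bdEqual (Term.var (Sum.inr x)) (Term.var (Sum.inr y))

/-- `∀ x, φ x` -/
def fAll (φ : Fin (n + 1) → Fml (n + 1)) : Fml n := (φ (Fin.last n)).all

/-- `∃ x, φ x` -/
def fEx (φ : Fin (n + 1) → Fml (n + 1)) : Fml n := (φ (Fin.last n)).ex

/-- `∀ x ∈ a, φ x` -/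
def fAllIn (a : Fin n) (φ : Fin (n + 1) → Fml (n + 1)) : Fml n :=
  fAll fun x => fMem x a ⟶ᶠ φ x

/-- `∃ x ∈ a, φ x` -/
def fExIn (a : Fin n) (φ : Fin (n + 1) → Fml (n + 1)) : Fml n :=
  fEx fun x => fMem x a ⋏ φ x

/-- `x ⊆ y` -/
def fSub (x y : Fin n) : Fml n := fAllIn x fun z => fMem z y

/-- `x ≠ ∅` -/
def fNonempty (x : Fin n) : Fml n := fEx fun y => fMem y x

/-- `c = {a, b}` -/
def fPair (c a b : Fin n) : Fml n :=
  fAll fun z => fMem z c ⟷ᶠ (fEq z a ⋎ fEq z b)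

/-- `p = (a, b)`, the Kuratowski pair `{{a}, {a, b}}` -/
def fOPair (p a b : Fin n) : Fml n :=
  fEx fun u => fEx fun v => fPair u a a ⋏ fPair v a b ⋏ fPair p u v

/-- `(x, y) ∈ f` -/
def fApp (f x y : Fin n) : Fml n := fExIn f fun p => fOPair p x y

/-- `f` is a function from `X` to `Y` (a set of ordered pairs). -/
def fFun (f X Y : Fin n) : Fml n :=
  (fAllIn f fun p => fExIn X fun x => fExIn Y fun y => fOPair p x y) ⋏
  (fAllIn X fun x => fEx fun y => fApp f x y ⋏ fAll fun z => fApp f x z ⟶ᶠ fEq z y)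

/-- `f` is a function from `X` onto `Y`. -/
def fSurj (f X Y : Fin n) : Fml n :=
  fFun f X Y ⋏ fAllIn Y fun y => fExIn X fun x => fApp f x y

/-- `f` is a bijection from `X` to `Y`. -/
def fBij (f X Y : Fin n) : Fml n :=
  fSurj f X Y ⋏
    fAll fun x => fAll fun x' => fAll fun y => (fApp f x y ⋏ fApp f x' y) ⟶ᶠ fEq x x'

/-- `|X| = |Y|` -/
def fEquinum (X Y : Fin n) : Fml n := fEx fun f => fBij f X Y

/-- `x` is a transitive set. -/
def fTrans (x : Fin n) : Fml n := fAllIn x fun y => fSub y x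

/-- `x` is a (von Neumann) ordinal: a transitive set of transitive sets. -/
def fOrd (x : Fin n) : Fml n := fTrans x ⋏ fAllIn x fun y => fTrans y

/-- `k` is a cardinal in `On`: an ordinal not equinumerous with any of its elements. -/
def fCard (k : Fin n) : Fml n := fOrd k ⋏ fAllIn k fun a => fNot (fEquinum a k)

/-- The function `f` takes at most one value on the elements of `D`. -/
def fConst (f D : Fin n) : Fml n :=
  fAllIn D fun x => fAllIn D fun y => fAll fun a => fAll fun b =>
    (fApp f x a ⋏ fApp f y b) ⟶ᶠ fEq a b

/-- `P = [X]²`, the set of all two-element subsets of `X` -/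
def fPairs (P X : Fin n) : Fml n :=
  fAll fun z => fMem z P ⟷ᶠ (fExIn X fun a => fExIn X fun b => fNot (fEq a b) ⋏ fPair z a b)

/-- `l → (k)¹_m`: every function from `l` to `m` is constant on a subset of `l` of size `k`. -/
def fArrowOne (l k m : Fin n) : Fml n :=
  fAll fun f => fFun f l m ⟶ᶠ fEx fun H => fSub H l ⋏ fEquinum H k ⋏ fConst f H

/-- `l → (k)²_m`: every function `c` from `[l]²` to `m` has a homogeneous set `H ⊆ l` of
size `k`, that is, `c` is constant on `[H]²`. -/
def fArrowTwo (l k m : Fin n) : Fml n :=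
  fEx fun P => fPairs P l ⋏ fAll fun c => fFun c P m ⟶ᶠ
    fEx fun H => fSub H l ⋏ fEquinum H k ⋏ fEx fun Q => fPairs Q H ⋏ fConst c Q

/-- `S = m^{<s}`, the set of all functions from some element of `s` to `m` -/
def fSeqs (S m s : Fin n) : Fml n :=
  fAll fun t => fMem t S ⟷ᶠ fExIn s fun z => fFun t z m

/-- `a = h(X)`: `a` is the least nonzero ordinal onto which no function maps `X`. -/
def fH (a X : Fin n) : Fml n :=
  fOrd a ⋏ fNonempty a ⋏ fNot (fEx fun f => fSurj f X a) ⋏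
    fAllIn a fun b => fNonempty b ⟶ᶠ fEx fun f => fSurj f X b

end Formulas

/-! ### The theory ZF -/

/-- The formula `φ` with its free variable `i` replaced by the variable `g i`. -/
def inst {k n : ℕ} (φ : setLang.Formula (Fin k)) (g : Fin k → Fin n) : Fml n :=
  BoundedFormula.relabel (n := n) (k := 0) (fun i => Sum.inr (g i)) φ

def extensionality : setLang.Sentence :=
  fAll (n := 0) fun x => fAll fun y => (fAll fun z => fMem z x ⟷ᶠ fMem z y) ⟶ᶠ fEq x y

def foundation : setLang.Sentence :=
  fAll (n := 0) fun x => fNonempty x ⟶ᶠ fExIn x fun y => fNot (fExIn y fun z => fMem z x)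

def pairing : setLang.Sentence :=
  fAll (n := 0) fun a => fAll fun b => fEx fun c => fPair c a b

def union : setLang.Sentence :=
  fAll (n := 0) fun a => fEx fun u => fAll fun x => fMem x u ⟷ᶠ fExIn a fun y => fMem x y

def powerSet : setLang.Sentence :=
  fAll (n := 0) fun a => fEx fun p => fAll fun x => fMem x p ⟷ᶠ fSub x a

/-- There is a set `w` with `∅ ∈ w` and `x ∪ {x} ∈ w` for all `x ∈ w`. -/
def infinity : setLang.Sentence :=
  fEx (n := 0) fun w => (fExIn w fun e => fNot (fNonempty e)) ⋏
    fAllIn w fun x => fExIn w fun y => fAll fun z => fMem z y ⟷ᶠ (fMem z x ⋎ fEq z x)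

/-- Separation for `φ(p, x)` with parameters `p = (p₀, …, pₙ₋₁)`:
`∀ p, ∀ a, ∃ b, ∀ x, x ∈ b ↔ x ∈ a ∧ φ(p, x)`. -/
def separation (n : ℕ) (φ : setLang.Formula (Fin (n + 1))) : setLang.Sentence :=
  (fAll fun a => fEx fun b => fAll fun x =>
    fMem x b ⟷ᶠ (fMem x a ⋏
      inst φ (Fin.snoc (α := fun _ => Fin (n + 3)) (fun p : Fin n => p.castAdd 3) x))
    : Fml n).alls

/-- Replacement for `φ(p, x, y)` with parameters `p = (p₀, …, pₙ₋₁)`: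
`∀ p, ∀ a, (∀ x ∈ a, ∀ y z, φ(p, x, y) ∧ φ(p, x, z) → y = z) →
∃ b, ∀ y, y ∈ b ↔ ∃ x ∈ a, φ(p, x, y)`. -/
def replacement (n : ℕ) (φ : setLang.Formula (Fin (n + 2))) : setLang.Sentence :=
  (fAll fun a =>
    (fAllIn a fun x => fAll fun y => fAll fun z =>
      (inst φ (Fin.snoc (α := fun _ => Fin (n + 4))
          (Fin.snoc (α := fun _ => Fin (n + 4)) (fun p : Fin n => p.castAdd 4) x) y) ⋏
        inst φ (Fin.snoc (α := fun _ => Fin (n + 4))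
          (Fin.snoc (α := fun _ => Fin (n + 4)) (fun p : Fin n => p.castAdd 4) x) z)) ⟶ᶠ
      fEq y z) ⟶ᶠ
    fEx fun b => fAll fun y => fMem y b ⟷ᶠ fExIn a fun x =>
      inst φ (Fin.snoc (α := fun _ => Fin (n + 4))
        (Fin.snoc (α := fun _ => Fin (n + 4)) (fun p : Fin n => p.castAdd 4) x) y)
    : Fml n).alls

/-- Zermelo–Fraenkel set theory without the axiom of choice. -/
def ZF : setLang.Theory :=
  {extensionality, foundation, pairing, union, powerSet, infinity} ∪
    {ψ | ∃ n φ, ψ = separation n φ} ∪ {ψ | ∃ n φ, ψ = replacement n φ}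

/-! ### The partition theorem as a sentence of set theory -/

/-- For every cardinal `k ∈ On` and every ordinal `m`: there is a cardinal `l ∈ On` with
`l → (k)²_m`; moreover there is a cardinal `s ∈ On` with `s → (k)¹_m`, and for every such `s`
the ordinal `l = h(m^{<s})` exists, is a cardinal and satisfies `l → (k)²_m`. -/
def erdosRado : setLang.Sentence :=
  fAll (n := 0) fun k => fAll fun m => (fCard k ⋏ fOrd m) ⟶ᶠ
    ((fEx fun l => fCard l ⋏ fArrowTwo l k m) ⋏
     (fEx fun s => fCard s ⋏ fArrowOne s k m) ⋏
     (fAll fun s => (fCard s ⋏ fArrowOne s k m) ⟶ᶠ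
        fEx fun S => fSeqs S m s ⋏ fEx fun l => fH l S ⋏ fCard l ⋏ fArrowTwo l k m))

/-! ### What the formulas say in a structure -/

section Semantics

variable {M : Type*} [setLang.Structure M]

/-- Membership in a structure for the language of set theory. -/
def Mem (x y : M) : Prop := Structure.RelMap (L := setLang) SetRel.mem ![x, y]

def Sub (x y : M) : Prop := ∀ z, Mem z x → Mem z y

def IsPair (c a b : M) : Prop := ∀ z, Mem z c ↔ z = a ∨ z = b

def IsOPair (p a b : M) : Prop := ∃ u v, IsPair u a a ∧ IsPair v a b ∧ IsPair p u v

def App (f x y : M) : Prop := ∃ p, Mem p f ∧ IsOPair p x y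

def IsFun (f X Y : M) : Prop :=
  (∀ p, Mem p f → ∃ x, Mem x X ∧ ∃ y, Mem y Y ∧ IsOPair p x y) ∧
  ∀ x, Mem x X → ∃ y, App f x y ∧ ∀ z, App f x z → z = y

def IsSurj (f X Y : M) : Prop := IsFun f X Y ∧ ∀ y, Mem y Y → ∃ x, Mem x X ∧ App f x y

def IsBij (f X Y : M) : Prop :=
  IsSurj f X Y ∧ ∀ x x' y, App f x y → App f x' y → x = x'

def Equinum (X Y : M) : Prop := ∃ f, IsBij f X Y

def IsTrans (x : M) : Prop := ∀ y, Mem y x → Sub y x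

def IsOrd (x : M) : Prop := IsTrans x ∧ ∀ y, Mem y x → IsTrans y

def IsCard (k : M) : Prop := IsOrd k ∧ ∀ a, Mem a k → ¬ Equinum a k

def ConstOn (f D : M) : Prop :=
  ∀ x, Mem x D → ∀ y, Mem y D → ∀ a b, App f x a → App f y b → a = b

def IsPairs (P X : M) : Prop :=
  ∀ z, Mem z P ↔ ∃ a, Mem a X ∧ ∃ b, Mem b X ∧ a ≠ b ∧ IsPair z a b

def ArrowOne (l k m : M) : Prop :=
  ∀ f, IsFun f l m → ∃ H, Sub H l ∧ Equinum H k ∧ ConstOn f H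

def ArrowTwo (l k m : M) : Prop :=
  ∃ P, IsPairs P l ∧ ∀ c, IsFun c P m →
    ∃ H, Sub H l ∧ Equinum H k ∧ ∃ Q, IsPairs Q H ∧ ConstOn c Q

def IsSeqs (S m s : M) : Prop := ∀ t, Mem t S ↔ ∃ z, Mem z s ∧ IsFun t z m

def IsH (a X : M) : Prop :=
  IsOrd a ∧ (∃ y, Mem y a) ∧ (¬ ∃ f, IsSurj f X a) ∧
    ∀ b, Mem b a → (∃ y, Mem y b) → ∃ f, IsSurj f X b

variable {n : ℕ} {v : Empty → M} {xs : Fin n → M}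

@[simp] theorem realize_fNot (φ : Fml n) : (fNot φ).Realize v xs ↔ ¬ φ.Realize v xs := by
  simp [fNot]

@[simp] theorem realize_fAnd (φ ψ : Fml n) :
    (φ ⋏ ψ).Realize v xs ↔ φ.Realize v xs ∧ ψ.Realize v xs := by
  simp [fAnd]

@[simp] theorem realize_fOr (φ ψ : Fml n) :
    (φ ⋎ ψ).Realize v xs ↔ φ.Realize v xs ∨ ψ.Realize v xs := by
  simp [fOr]

@[simp] theorem realize_fImp (φ ψ : Fml n) :
    (φ ⟶ᶠ ψ).Realize v xs ↔ (φ.Realize v xs → ψ.Realize v xs) := by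
  simp [fImp]

@[simp] theorem realize_fIff (φ ψ : Fml n) :
    (φ ⟷ᶠ ψ).Realize v xs ↔ (φ.Realize v xs ↔ ψ.Realize v xs) := by
  simp [fIff]

@[simp] theorem realize_fMem (x y : Fin n) :
    (fMem x y).Realize v xs ↔ Mem (xs x) (xs y) := by
  exact BoundedFormula.realize_rel₂

@[simp] theorem realize_fEq (x y : Fin n) :
    (fEq x y).Realize v xs ↔ xs x = xs y := by
  simp [fEq]

@[simp] theorem realize_fAll (φ : Fin (n + 1) → Fml (n + 1)) :
    (fAll φ).Realize v xs ↔
      ∀ a : M, (φ (Fin.last n)).Realize v (Fin.snoc (α := fun _ => M) xs a) := Iff.rfl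

@[simp] theorem realize_fEx (φ : Fin (n + 1) → Fml (n + 1)) :
    (fEx φ).Realize v xs ↔
      ∃ a : M, (φ (Fin.last n)).Realize v (Fin.snoc (α := fun _ => M) xs a) := by
  simp [fEx]

@[simp] theorem realize_fAllIn (a : Fin n) (φ : Fin (n + 1) → Fml (n + 1)) :
    (fAllIn a φ).Realize v xs ↔ ∀ x : M, Mem x (xs a) →
      (φ (Fin.last n)).Realize v (Fin.snoc (α := fun _ => M) xs x) := by
  simp [fAllIn]

@[simp] theorem realize_fExIn (a : Fin n) (φ : Fin (n + 1) → Fml (n + 1)) :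
    (fExIn a φ).Realize v xs ↔ ∃ x : M, Mem x (xs a) ∧
      (φ (Fin.last n)).Realize v (Fin.snoc (α := fun _ => M) xs x) := by
  simp [fExIn]

@[simp] theorem realize_fSub (x y : Fin n) :
    (fSub x y).Realize v xs ↔ Sub (xs x) (xs y) := by
  simp [fSub, Sub]

@[simp] theorem realize_fNonempty (x : Fin n) :
    (fNonempty x).Realize v xs ↔ ∃ y, Mem y (xs x) := by
  simp [fNonempty]

@[simp] theorem realize_fPair (c a b : Fin n) :
    (fPair c a b).Realize v xs ↔ IsPair (xs c) (xs a) (xs b) := by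
  simp [fPair, IsPair]

@[simp] theorem realize_fOPair (p a b : Fin n) :
    (fOPair p a b).Realize v xs ↔ IsOPair (xs p) (xs a) (xs b) := by
  simp [fOPair, IsOPair]

@[simp] theorem realize_fApp (f x y : Fin n) :
    (fApp f x y).Realize v xs ↔ App (xs f) (xs x) (xs y) := by
  simp [fApp, App]

@[simp] theorem realize_fFun (f X Y : Fin n) :
    (fFun f X Y).Realize v xs ↔ IsFun (xs f) (xs X) (xs Y) := by
  simp [fFun, IsFun]

@[simp] theorem realize_fSurj (f X Y : Fin n) :
    (fSurj f X Y).Realize v xs ↔ IsSurj (xs f) (xs X) (xs Y) := by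
  simp [fSurj, IsSurj]

@[simp] theorem realize_fBij (f X Y : Fin n) :
    (fBij f X Y).Realize v xs ↔ IsBij (xs f) (xs X) (xs Y) := by
  simp [fBij, IsBij]

@[simp] theorem realize_fEquinum (X Y : Fin n) :
    (fEquinum X Y).Realize v xs ↔ Equinum (xs X) (xs Y) := by
  simp [fEquinum, Equinum]

@[simp] theorem realize_fTrans (x : Fin n) :
    (fTrans x).Realize v xs ↔ IsTrans (xs x) := by
  simp [fTrans, IsTrans]

@[simp] theorem realize_fOrd (x : Fin n) :
    (fOrd x).Realize v xs ↔ IsOrd (xs x) := by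
  simp [fOrd, IsOrd]

@[simp] theorem realize_fCard (k : Fin n) :
    (fCard k).Realize v xs ↔ IsCard (xs k) := by
  simp [fCard, IsCard]

@[simp] theorem realize_fConst (f D : Fin n) :
    (fConst f D).Realize v xs ↔ ConstOn (xs f) (xs D) := by
  simp [fConst, ConstOn]

@[simp] theorem realize_fPairs (P X : Fin n) :
    (fPairs P X).Realize v xs ↔ IsPairs (xs P) (xs X) := by
  simp [fPairs, IsPairs]

@[simp] theorem realize_fArrowOne (l k m : Fin n) :
    (fArrowOne l k m).Realize v xs ↔ ArrowOne (xs l) (xs k) (xs m) := by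
  simp [fArrowOne, ArrowOne]

@[simp] theorem realize_fArrowTwo (l k m : Fin n) :
    (fArrowTwo l k m).Realize v xs ↔ ArrowTwo (xs l) (xs k) (xs m) := by
  simp [fArrowTwo, ArrowTwo]

@[simp] theorem realize_fSeqs (S m s : Fin n) :
    (fSeqs S m s).Realize v xs ↔ IsSeqs (xs S) (xs m) (xs s) := by
  simp [fSeqs, IsSeqs]

@[simp] theorem realize_fH (a X : Fin n) :
    (fH a X).Realize v xs ↔ IsH (xs a) (xs X) := by
  simp [fH, IsH]

@[simp] theorem realize_inst {k : ℕ} (φ : setLang.Formula (Fin k)) (g : Fin k → Fin n) :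
    (inst φ g).Realize v xs ↔ φ.Realize fun i => xs (g i) := by
  rw [inst, BoundedFormula.realize_relabel, Formula.Realize]
  exact iff_of_eq (congrArg₂ _ (funext fun _ => rfl) (Subsingleton.elim _ _))

theorem realize_extensionality : M ⊨ extensionality ↔
    ∀ x y : M, (∀ z, Mem z x ↔ Mem z y) → x = y := by
  simp [extensionality, Sentence.Realize, Formula.Realize]
  rfl

theorem realize_foundation : M ⊨ foundation ↔
    ∀ x : M, (∃ y, Mem y x) → ∃ y, Mem y x ∧ ¬ ∃ z, Mem z y ∧ Mem z x := by
  simp [foundation, Sentence.Realize, Formula.Realize]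
  rfl

theorem realize_pairing : M ⊨ pairing ↔ ∀ a b : M, ∃ c, IsPair c a b := by
  simp [pairing, Sentence.Realize, Formula.Realize]
  rfl

theorem realize_union : M ⊨ union ↔
    ∀ a : M, ∃ u, ∀ x, Mem x u ↔ ∃ y, Mem y a ∧ Mem x y := by
  simp [union, Sentence.Realize, Formula.Realize]
  rfl

theorem realize_powerSet : M ⊨ powerSet ↔ ∀ a : M, ∃ p, ∀ x, Mem x p ↔ Sub x a := by
  simp [powerSet, Sentence.Realize, Formula.Realize]
  rfl

theorem realize_infinity : M ⊨ infinity ↔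
    ∃ w : M, (∃ e, Mem e w ∧ ¬ ∃ y, Mem y e) ∧
      ∀ x, Mem x w → ∃ y, Mem y w ∧ ∀ z, Mem z y ↔ Mem z x ∨ z = x := by
  simp [infinity, Sentence.Realize, Formula.Realize]
  rfl

theorem realize_separation (n : ℕ) (φ : setLang.Formula (Fin (n + 1))) :
    M ⊨ separation n φ ↔ ∀ (p : Fin n → M) (a : M), ∃ b, ∀ x,
      Mem x b ↔ Mem x a ∧ φ.Realize (Fin.snoc (α := fun _ => M) p x) := by
  rw [separation, Sentence.Realize, BoundedFormula.realize_alls]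
  simp only [realize_fAll, realize_fEx, realize_fIff, realize_fMem, realize_fAnd, realize_inst,
    Fin.snoc_last, Fin.snoc_castSucc]
  refine forall_congr' fun p => forall_congr' fun a => exists_congr fun b =>
    forall_congr' fun x => iff_congr Iff.rfl (and_congr_right fun _ => iff_of_eq (congrArg _ ?_))
  funext i
  refine Fin.lastCases ?_ (fun j => ?_) i
  · simp
  · simp only [Fin.snoc_castSucc]
    exact (Fin.snoc_castSucc (α := fun _ => M) _ _ j.castSucc.castSucc).trans
      ((Fin.snoc_castSucc (α := fun _ => M) _ _ j.castSucc).trans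
        (Fin.snoc_castSucc (α := fun _ => M) _ _ j))

theorem realize_replacement (n : ℕ) (φ : setLang.Formula (Fin (n + 2))) :
    M ⊨ replacement n φ ↔ ∀ (p : Fin n → M) (a : M),
      (∀ x, Mem x a → ∀ y z,
        φ.Realize (Fin.snoc (α := fun _ => M) (Fin.snoc (α := fun _ => M) p x) y) →
        φ.Realize (Fin.snoc (α := fun _ => M) (Fin.snoc (α := fun _ => M) p x) z) → y = z) →
      ∃ b, ∀ y, Mem y b ↔ ∃ x, Mem x a ∧
        φ.Realize (Fin.snoc (α := fun _ => M) (Fin.snoc (α := fun _ => M) p x) y) := by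
  have key : ∀ (p : Fin n → M) (a b c d : M) (i j : Fin (n + 4)),
      (fun k : Fin (n + 2) => Fin.snoc (α := fun _ => M) (Fin.snoc (α := fun _ => M)
        (Fin.snoc (α := fun _ => M) (Fin.snoc (α := fun _ => M) p a) b) c) d
        (Fin.snoc (α := fun _ => Fin (n + 4)) (Fin.snoc (α := fun _ => Fin (n + 4))
          (fun q : Fin n => q.castAdd 4) i) j k)) =
      Fin.snoc (α := fun _ => M) (Fin.snoc (α := fun _ => M) p
        (Fin.snoc (α := fun _ => M) (Fin.snoc (α := fun _ => M)
        (Fin.snoc (α := fun _ => M) (Fin.snoc (α := fun _ => M) p a) b) c) d i))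
        (Fin.snoc (α := fun _ => M) (Fin.snoc (α := fun _ => M)
        (Fin.snoc (α := fun _ => M) (Fin.snoc (α := fun _ => M) p a) b) c) d j) := by
    intro p a b c d i j
    funext k
    refine Fin.lastCases ?_ (fun k => Fin.lastCases ?_ (fun k => ?_) k) k
    · simp only [Fin.snoc_last]
    · simp only [Fin.snoc_last, Fin.snoc_castSucc]
    · simp only [Fin.snoc_castSucc]
      exact (Fin.snoc_castSucc (α := fun _ => M) _ _ k.castSucc.castSucc.castSucc).trans
        ((Fin.snoc_castSucc (α := fun _ => M) _ _ k.castSucc.castSucc).trans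
        ((Fin.snoc_castSucc (α := fun _ => M) _ _ k.castSucc).trans
        (Fin.snoc_castSucc (α := fun _ => M) _ _ k)))
  rw [replacement, Sentence.Realize, BoundedFormula.realize_alls]
  simp only [realize_fAll, realize_fEx, realize_fIff, realize_fMem, realize_fAnd, realize_inst,
    realize_fImp, realize_fAllIn, realize_fExIn, realize_fEq, key,
    Fin.snoc_last, Fin.snoc_castSucc, and_imp]

/-- The meaning of the partition theorem in a structure. -/
theorem realize_erdosRado : M ⊨ erdosRado ↔
    ∀ k m : M, IsCard k → IsOrd m →
      (∃ l, IsCard l ∧ ArrowTwo l k m) ∧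
      (∃ s, IsCard s ∧ ArrowOne s k m) ∧
      ∀ s, IsCard s → ArrowOne s k m →
        ∃ S, IsSeqs S m s ∧ ∃ l, IsH l S ∧ IsCard l ∧ ArrowTwo l k m := by
  simp [erdosRado, Sentence.Realize, Formula.Realize]
  rfl

end Semantics

end ZFSetTheory

set_option linter.unusedSectionVars false

open FirstOrder FirstOrder.Language

namespace ZFSetTheory

/-! The sentence is checked in an arbitrary model `M` of ZF. Arguments take place inside `M`, so
every class, recursion or map handed to an axiom scheme must be first-order definable with
parameters. `DefP` and `DefF` record this.

Choice is avoided in two ways. Sequences always take the least admissible ordinal, and cardinal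
successors are replaced by `h(X)`, which exists in ZF because a surjection of `X` onto an ordinal is
coded by a relation on `X` (`exists_isH`). Contradictions then come from exhibiting a forbidden
surjection.

For exponent 1, take `σ = h(μ × κ)` and `f : σ → μ`. Enumerate each fibre of `f` in increasing
order. If some `b` has `κ` predecessors in its fibre, these form a homogeneous set. Otherwise `b` is
the `η`-th element of the fibre of `f b` for some `η < κ`, and `(i, η) ↦` (`η`-th element of fibre
`i`) maps `μ × κ` onto `σ`.

For exponent 2, let `σ → (κ)¹_μ` and `l = h(μ^{<σ})`, and let `c` colour `[l]²`. For `α < l` let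
`g_α(ξ)` be the least `β < l` above all earlier terms with `c{g_α(η), β} = c{g_α(η), α}` for all `η
< ξ`. While the sequence stays below `α`, `α` itself is a candidate, so the sequence either stays
below `α` for `σ` steps or reaches `α` earlier. In the first case `c{g_α(η), g_α(ξ)}` depends only
on `η` for `η < ξ`, and `σ → (κ)¹_μ` applied to `η ↦ c{g_α(η), α}` thins the sequence to a
homogeneous set. If the second case holds for every `α`, the colours met on the way to `α` form an
element of `μ^{<σ}` that determines `α`, since `g_α` can be rebuilt from them. Inverting this
injection maps `μ^{<σ}` onto `l`, against the choice of `l`. -/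

/-- A type of contexts: tuples of elements of `M`, presented as valuations of finitely many
variables. -/
class Ctx (M : outParam (Type*)) (Γ : Type*) where
  /-- The variables of the context. -/
  Var : Type
  finite : Finite Var
  /-- The value of a variable. -/
  get : Γ → Var → M

/-! ### Definability with parameters, and the axiom schemes for definable classes and maps -/

section

universe u
variable {M : Type u} [setLang.Structure M] {Γ Δ Θ : Type u} [Ctx M Γ] [Ctx M Δ] [Ctx M Θ]

instance : Ctx M M := ⟨Unit, inferInstance, fun x _ => x⟩

instance : Ctx M (Γ × Δ) :=
  ⟨Ctx.Var Γ ⊕ Ctx.Var Δ,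
    have := Ctx.finite (Γ := Γ); have := Ctx.finite (Γ := Δ); inferInstance,
    fun v => Sum.elim (Ctx.get v.1) (Ctx.get v.2)⟩

/-- `P` is first-order definable with parameters. -/
@[fun_prop]
def DefP (P : Γ → Prop) : Prop :=
  ∃ φ : setLang.Formula (M ⊕ Ctx.Var Γ), ∀ v, P v ↔ φ.Realize (Sum.elim id (Ctx.get v))

/-- `f` is a map whose graph is first-order definable with parameters. -/
@[fun_prop]
def DefF (f : Γ → Δ) : Prop :=
  ∀ i : Ctx.Var Δ, DefP fun w : Γ × M => w.2 = Ctx.get (f w.1) i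

theorem DefP.congr {P Q : Γ → Prop} (h : DefP P) (e : ∀ v, Q v ↔ P v) : DefP Q :=
  (funext fun v => propext (e v) : Q = P) ▸ h

@[fun_prop]
theorem DefP.not {P : Γ → Prop} (h : DefP P) : DefP fun v => ¬ P v := by
  obtain ⟨φ, hφ⟩ := h
  exact ⟨∼φ, fun v => (not_congr (hφ v)).trans Formula.realize_not.symm⟩

@[fun_prop]
theorem DefP.and {P Q : Γ → Prop} (hP : DefP P) (hQ : DefP Q) : DefP fun v => P v ∧ Q v := by
  obtain ⟨φ, hφ⟩ := hP
  obtain ⟨ψ, hψ⟩ := hQ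
  exact ⟨φ ⊓ ψ, fun v => (and_congr (hφ v) (hψ v)).trans Formula.realize_inf.symm⟩

@[fun_prop]
theorem DefP.or {P Q : Γ → Prop} (hP : DefP P) (hQ : DefP Q) : DefP fun v => P v ∨ Q v :=
  (hP.not.and hQ.not).not.congr fun v => by tauto

theorem DefP.imp {P Q : Γ → Prop} (hP : DefP P) (hQ : DefP Q) : DefP fun v => P v → Q v :=
  (hP.and hQ.not).not.congr fun v => by tauto

@[fun_prop]
theorem DefP.iff {P Q : Γ → Prop} (hP : DefP P) (hQ : DefP Q) : DefP fun v => P v ↔ Q v :=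
  ((hP.imp hQ).and (hQ.imp hP)).congr fun v => by tauto

@[fun_prop]
theorem DefP.ex {P : Γ → M → Prop} (h : DefP fun w : Γ × M => P w.1 w.2) :
    DefP fun v => ∃ x, P v x := by
  obtain ⟨φ, hφ⟩ := h
  refine ⟨Formula.iExs Unit (φ.relabel (Sum.elim (fun a => Sum.inl (Sum.inl a))
    (Sum.elim (fun i => Sum.inl (Sum.inr i)) Sum.inr)) :
      setLang.Formula ((M ⊕ Ctx.Var Γ) ⊕ Unit)), fun v => ?_⟩
  rw [Formula.realize_iExs]
  have key : ∀ x : Unit → M, (Formula.relabel (Sum.elim (fun a => Sum.inl (Sum.inl a))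
      (Sum.elim (fun i => Sum.inl (Sum.inr i)) Sum.inr)) φ :
        setLang.Formula ((M ⊕ Ctx.Var Γ) ⊕ Unit)).Realize
      (Sum.elim (Sum.elim id (Ctx.get v)) x) ↔ P v (x ()) := by
    intro x
    rw [Formula.realize_relabel]
    refine Iff.trans ?_ (hφ (v, x ())).symm
    refine iff_of_eq (congrArg _ (funext fun i => ?_))
    rcases i with i | i | i <;> rfl
  exact ⟨fun ⟨x, hx⟩ => ⟨fun _ => x, (key _).2 hx⟩, fun ⟨x, hx⟩ => ⟨x (), (key _).1 hx⟩⟩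

theorem DefP.all {P : Γ → M → Prop} (h : DefP fun w : Γ × M => P w.1 w.2) :
    DefP fun v => ∀ x, P v x :=
  (DefP.ex (P := fun v x => ¬ P v x) h.not).not.congr fun v => by simp

theorem DefP.const (p : Prop) : DefP fun _ : Γ => p := by
  by_cases h : p
  · exact ⟨⊤, fun v => by simp [h]⟩
  · exact ⟨⊥, fun v => by simp [h]⟩

/-- Equality of variables and constants is definable. -/
theorem DefP.var_eq (a b : M ⊕ Ctx.Var Γ) :
    DefP fun v : Γ => Sum.elim id (Ctx.get v) a = Sum.elim id (Ctx.get v) b :=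
  ⟨Term.equal (Term.var a) (Term.var b), fun v => by simp [Formula.realize_equal]⟩

theorem DefP.var_mem (a b : M ⊕ Ctx.Var Γ) :
    DefP fun v : Γ => Mem (Sum.elim id (Ctx.get v) a) (Sum.elim id (Ctx.get v) b) :=
  ⟨Relations.formula₂ (L := setLang) SetRel.mem (Term.var a) (Term.var b), fun v =>
    (Formula.realize_rel₂ (L := setLang) (R := SetRel.mem) (t₁ := Term.var a) (t₂ := Term.var b)
      (v := Sum.elim id (Ctx.get v))).symm⟩

@[fun_prop]
theorem DefF.id : DefF fun v : Γ => v := fun i =>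
  DefP.var_eq (Γ := Γ × M) (Sum.inr (Sum.inr ())) (Sum.inr (Sum.inl i))

@[fun_prop]
theorem DefF.const (c : Δ) : DefF fun _ : Γ => c := fun i =>
  DefP.var_eq (Γ := Γ × M) (Sum.inr (Sum.inr ())) (Sum.inl (Ctx.get c i))

-- Substitution existentially quantifies the coordinates of `f v` and asserts their definitions. The
-- conjunction over coordinates is a formula because contexts have finitely many variables.
@[fun_prop]
theorem DefP.comp {P : Δ → Prop} {f : Γ → Δ} (hP : DefP P) (hf : DefF f) :
    DefP fun v => P (f v) := by
  obtain ⟨φ, hφ⟩ := hP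
  choose ψ hψ using hf
  have := Ctx.finite (Γ := Δ)
  let χ : setLang.Formula ((M ⊕ Ctx.Var Γ) ⊕ Ctx.Var Δ) :=
    (φ.relabel (Sum.elim (fun a => Sum.inl (Sum.inl a)) Sum.inr)) ⊓
    Formula.iInf fun i => (ψ i).relabel (Sum.elim (fun a => Sum.inl (Sum.inl a))
      (Sum.elim (fun j => Sum.inl (Sum.inr j)) fun _ => Sum.inr i))
  refine ⟨χ.iExs (Ctx.Var Δ), fun v => ?_⟩
  rw [Formula.realize_iExs]
  have key : ∀ x : Ctx.Var Δ → M, χ.Realize (Sum.elim (Sum.elim id (Ctx.get v)) x) ↔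
      φ.Realize (Sum.elim id x) ∧ ∀ i, x i = Ctx.get (f v) i := by
    intro x
    rw [Formula.realize_inf, Formula.realize_iInf, Formula.realize_relabel]
    refine and_congr (iff_of_eq (congrArg _ (funext fun i => ?_))) (forall_congr' fun i => ?_)
    · rcases i with i | i <;> rfl
    · rw [Formula.realize_relabel]
      refine Iff.trans (iff_of_eq (congrArg _ (funext fun j => ?_))) (hψ i (v, x i)).symm
      rcases j with j | j | j <;> rfl
  simp only [key]
  refine ⟨fun h => ⟨Ctx.get (f v), (hφ _).1 h, fun _ => rfl⟩, fun ⟨x, hx, e⟩ => ?_⟩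
  rw [hφ, ← funext e]
  exact hx

theorem DefF.fst_proj : DefF fun w : Γ × Δ => w.1 := fun i =>
  DefP.var_eq (Γ := (Γ × Δ) × M) (Sum.inr (Sum.inr ())) (Sum.inr (Sum.inl (Sum.inl i)))

theorem DefF.snd_proj : DefF fun w : Γ × Δ => w.2 := fun i =>
  DefP.var_eq (Γ := (Γ × Δ) × M) (Sum.inr (Sum.inr ())) (Sum.inr (Sum.inl (Sum.inr i)))

@[fun_prop]
theorem DefF.prodMk {f : Γ → Δ} {g : Γ → Θ} (hf : DefF f) (hg : DefF g) :
    DefF fun v => (f v, g v) := fun i => by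
  rcases i with i | i
  · exact hf i
  · exact hg i

@[fun_prop]
theorem DefF.comp {f : Δ → Θ} {g : Γ → Δ} (hf : DefF f) (hg : DefF g) :
    DefF fun v => f (g v) := fun i => by
  have h1 : DefF fun w : Γ × M => (g w.1, w.2) := by
    refine DefF.prodMk (fun j => ?_) DefF.snd_proj
    exact (hg j).comp (f := fun w : (Γ × M) × M => (w.1.1, w.2)) (fun k => by
      rcases k with k | k
      · exact DefP.var_eq (Γ := ((Γ × M) × M) × M) (Sum.inr (Sum.inr ()))
          (Sum.inr (Sum.inl (Sum.inl (Sum.inl k))))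
      · exact DefP.var_eq (Γ := ((Γ × M) × M) × M) (Sum.inr (Sum.inr ()))
          (Sum.inr (Sum.inl (Sum.inr ()))))
  exact (hf i).comp h1

@[fun_prop]
theorem DefF.fst {f : Γ → Δ × Θ} (hf : DefF f) : DefF fun v => (f v).1 :=
  DefF.comp DefF.fst_proj hf

@[fun_prop]
theorem DefF.snd {f : Γ → Δ × Θ} (hf : DefF f) : DefF fun v => (f v).2 :=
  DefF.comp DefF.snd_proj hf

@[fun_prop]
theorem DefP.mem {f g : Γ → M} (hf : DefF f) (hg : DefF g) : DefP fun v => Mem (f v) (g v) :=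
  DefP.comp (P := fun w : M × M => Mem w.1 w.2) (f := fun v => (f v, g v))
    (DefP.var_mem (Γ := M × M) (Sum.inr (Sum.inl ())) (Sum.inr (Sum.inr ()))) (hf.prodMk hg)

@[fun_prop]
theorem DefP.eq {f g : Γ → M} (hf : DefF f) (hg : DefF g) : DefP fun v => f v = g v :=
  DefP.comp (P := fun w : M × M => w.1 = w.2) (f := fun v => (f v, g v))
    (DefP.var_eq (Γ := M × M) (Sum.inr (Sum.inl ())) (Sum.inr (Sum.inr ()))) (hf.prodMk hg)

theorem DefF.of_graph {f : Γ → M} (h : DefP fun w : Γ × M => w.2 = f w.1) : DefF f :=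
  fun _ => h

/-- A formula mentions only finitely many elements of `M`. Collecting them in a tuple gives the
parameter form used by the separation and replacement schemes. -/
theorem formula_params {k : ℕ} (φ : setLang.Formula (M ⊕ Fin k)) :
    ∃ (n : ℕ) (p : Fin n → M) (ψ : setLang.Formula (Fin n ⊕ Fin k)), ∀ v : Fin k → M,
      φ.Realize (Sum.elim id v) ↔ ψ.Realize (Sum.elim p v) := by
  classical
  let e := (φ.freeVarFinset.toLeft).equivFin
  let g : φ.freeVarFinset → Fin φ.freeVarFinset.toLeft.card ⊕ Fin k := fun x =>
    match x with
    | ⟨Sum.inl a, h⟩ => Sum.inl (e ⟨a, Finset.mem_toLeft.2 h⟩)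
    | ⟨Sum.inr i, _⟩ => Sum.inr i
  refine ⟨_, fun i => (e.symm i : M), φ.restrictFreeVar g, fun v => ?_⟩
  refine (BoundedFormula.realize_restrictFreeVar _ ?_).symm
  rintro ⟨a | i, h⟩
  · simp [g]
  · simp [g]

/-- Separation for definable predicates. -/
theorem exists_sep [M ⊨ ZF] {P : M → Prop} (hP : DefP P) (a : M) :
    ∃ b, ∀ x, Mem x b ↔ Mem x a ∧ P x := by
  obtain ⟨φ, hφ⟩ := hP
  obtain ⟨n, p, ψ, hψ⟩ := formula_params
    (φ.relabel (Sum.map id fun _ => 0) : setLang.Formula (M ⊕ Fin 1))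
  obtain ⟨b, hb⟩ := (realize_separation n (ψ.relabel (Sum.elim Fin.castSucc fun _ => Fin.last n))).1
    (Theory.realize_sentence_of_mem ZF (Or.inl (Or.inr ⟨_, _, rfl⟩))) p a
  refine ⟨b, fun x => (hb x).trans (and_congr_right fun _ => ?_)⟩
  have h := hψ fun _ => x
  rw [Formula.realize_relabel] at h
  rw [Formula.realize_relabel, hφ]
  refine Iff.trans (iff_of_eq (congrArg _ (funext fun i => ?_))) (h.symm.trans
    (iff_of_eq (congrArg _ (funext fun i => ?_))))
  · rcases i with i | i <;> simp
  · rcases i with i | i <;> rfl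

/-- Replacement for definable functions. -/
theorem exists_image [M ⊨ ZF] {f : M → M} (hf : DefF f) (a : M) :
    ∃ b, ∀ y, Mem y b ↔ ∃ x, Mem x a ∧ y = f x := by
  obtain ⟨φ, hφ⟩ := hf ()
  obtain ⟨n, p, ψ, hψ⟩ := formula_params
    (φ.relabel (Sum.map id (Sum.elim (fun _ => 0) fun _ => 1)) : setLang.Formula (M ⊕ Fin 2))
  have key : ∀ x y, (ψ.relabel (Sum.elim (fun i => i.castSucc.castSucc)
      ![(Fin.last n).castSucc, Fin.last (n + 1)])).Realize
      (Fin.snoc (α := fun _ => M) (Fin.snoc (α := fun _ => M) p x) y) ↔ y = f x := by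
    intro x y
    have h := hψ ![x, y]
    rw [Formula.realize_relabel] at h
    rw [Formula.realize_relabel]
    refine Iff.trans (iff_of_eq (congrArg _ (funext fun i => ?_))) (h.symm.trans
      (Iff.trans (iff_of_eq (congrArg _ (funext fun i => ?_))) (hφ (x, y)).symm))
    · rcases i with i | i
      · simp
      · fin_cases i <;> simp
    · rcases i with i | i | i <;> rfl
  obtain ⟨b, hb⟩ := (realize_replacement n (ψ.relabel (Sum.elim (fun i => i.castSucc.castSucc)
      ![(Fin.last n).castSucc, Fin.last (n + 1)]))).1
    (Theory.realize_sentence_of_mem ZF (Or.inr ⟨_, _, rfl⟩)) p a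
    (fun x _ y z hy hz => ((key x y).1 hy).trans ((key x z).1 hz).symm)
  exact ⟨b, fun y => (hb y).trans (by simp only [key])⟩

/-- `DefP.all` and `DefP.imp` are not `fun_prop` rules. Definability goals are first rewritten with
this and `imp_iff_not_or`. -/
theorem forall_iff_not_exists {P : M → Prop} : (∀ x, P x) ↔ ¬ ∃ x, ¬ P x := not_exists_not.symm

/-! ### Definite descriptions and class terms -/

variable [Nonempty M]

open Classical in
/-- The unique element satisfying `Q`, if there is one. -/
noncomputable def the (Q : M → Prop) : M :=
  if h : ∃ y, ∀ z, Q z ↔ z = y then h.choose else Classical.arbitrary M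

theorem the_eq {Q : M → Prop} {y : M} (h : ∀ z, Q z ↔ z = y) : the Q = y := by
  have h' : ∃ y, ∀ z, Q z ↔ z = y := ⟨y, h⟩
  rw [the, dif_pos h']
  exact (h _).1 ((h'.choose_spec _).2 rfl)

-- Unique existence is itself definable, and the default value is a single parameter, so the two
-- cases combine into one definable graph.
@[fun_prop]
theorem DefF.the {Q : Γ → M → Prop} (hQ : DefP fun w : Γ × M => Q w.1 w.2) :
    DefF fun v => the (Q v) := by
  refine DefF.of_graph (DefP.congr (P := fun w : Γ × M => (∀ z, Q w.1 z ↔ z = w.2) ∨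
    ((¬ ∃ y, ∀ z, Q w.1 z ↔ z = y) ∧ w.2 = Classical.arbitrary M)) ?_ fun w => ?_)
  · simp only [forall_iff_not_exists]
    fun_prop
  · by_cases h : ∃ y, ∀ z, Q w.1 z ↔ z = y
    · obtain ⟨y, hy⟩ := h
      have h' : ∃ y, ∀ z, Q w.1 z ↔ z = y := ⟨y, hy⟩
      rw [the_eq hy]
      simp only [h', not_true_eq_false, false_and, or_false]
      exact ⟨fun e => e ▸ hy, fun e => (hy _).1 ((e _).2 rfl)⟩
    · have h' : ¬ ∀ z, Q w.1 z ↔ z = w.2 := fun e => h ⟨_, e⟩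
      rw [ZFSetTheory.the, dif_neg h]
      simp only [h, h', not_false_eq_true, true_and, false_or]

@[fun_prop]
theorem DefF.ite {P : Γ → Prop} [DecidablePred P] {f g : Γ → M} (hP : DefP P) (hf : DefF f)
    (hg : DefF g) : DefF fun v => if P v then f v else g v := by
  refine DefF.of_graph (DefP.congr (P := fun w : Γ × M => (P w.1 ∧ w.2 = f w.1) ∨
    (¬ P w.1 ∧ w.2 = g w.1)) (by fun_prop) fun w => ?_)
  by_cases h : P w.1 <;> simp [h]

/-- The set of all `x` satisfying `P`, if there is such a set. -/
noncomputable def cls (P : M → Prop) : M := the fun b => ∀ x, Mem x b ↔ P x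

@[fun_prop]
theorem DefF.cls {P : Γ → M → Prop} (hP : DefP fun w : Γ × M => P w.1 w.2) :
    DefF fun v => cls (P v) := by
  refine DefF.the ?_
  simp only [forall_iff_not_exists]
  fun_prop

/-- The unordered pair `{a, b}`. -/
noncomputable def pr (a b : M) : M := cls fun x => x = a ∨ x = b

/-- The Kuratowski pair `(a, b)`. -/
noncomputable def opr (a b : M) : M := pr (pr a a) (pr a b)

/-- The union of the elements of `a`. -/
noncomputable def sUnion (a : M) : M := cls fun x => ∃ y, Mem y a ∧ Mem x y

/-- The successor `a ∪ {a}`. -/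
noncomputable def succ (a : M) : M := cls fun x => Mem x a ∨ x = a

/-- The power set. -/
noncomputable def pow (a : M) : M := cls fun x => Sub x a

/-- `{x ∈ a | P x}` -/
noncomputable def sep (a : M) (P : M → Prop) : M := cls fun x => Mem x a ∧ P x

/-- `{f x | x ∈ a}` -/
noncomputable def img (a : M) (f : M → M) : M := cls fun y => ∃ x, Mem x a ∧ y = f x

/-- The function `x ↦ f x` on the set `a`, as a set of ordered pairs. -/
noncomputable def lam (a : M) (f : M → M) : M := img a fun x => opr x (f x)

/-- The value of the internal function `f` at `x`. -/
noncomputable def ap (f x : M) : M := the fun y => App f x y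

/-- The Cartesian product. -/
noncomputable def prod (a b : M) : M :=
  cls fun p => ∃ x, Mem x a ∧ ∃ y, Mem y b ∧ p = opr x y

/-- `[a]²` -/
noncomputable def pairs (a : M) : M :=
  cls fun z => ∃ x, Mem x a ∧ ∃ y, Mem y a ∧ x ≠ y ∧ z = pr x y

section Definability

variable {f g h : Γ → M}

@[fun_prop]
theorem DefF.pr (hf : DefF f) (hg : DefF g) : DefF fun v => pr (f v) (g v) := by
  unfold ZFSetTheory.pr; fun_prop

@[fun_prop]
theorem DefF.opr (hf : DefF f) (hg : DefF g) : DefF fun v => opr (f v) (g v) := by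
  unfold ZFSetTheory.opr; fun_prop

@[fun_prop]
theorem DefF.succ (hf : DefF f) : DefF fun v => succ (f v) := by
  unfold ZFSetTheory.succ; fun_prop

@[fun_prop]
theorem DefF.img {k : Γ → M → M} (hf : DefF f) (hk : DefF fun w : Γ × M => k w.1 w.2) :
    DefF fun v => img (f v) (k v) := by
  unfold ZFSetTheory.img; fun_prop

@[fun_prop]
theorem DefF.lam {k : Γ → M → M} (hf : DefF f) (hk : DefF fun w : Γ × M => k w.1 w.2) :
    DefF fun v => lam (f v) (k v) := by
  unfold ZFSetTheory.lam; fun_prop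

@[fun_prop]
theorem DefP.sub (hf : DefF f) (hg : DefF g) : DefP fun v => Sub (f v) (g v) := by
  simp only [Sub, forall_iff_not_exists, imp_iff_not_or]; fun_prop

@[fun_prop]
theorem DefP.isPair (hf : DefF f) (hg : DefF g) (hh : DefF h) :
    DefP fun v => IsPair (f v) (g v) (h v) := by
  simp only [IsPair, forall_iff_not_exists]; fun_prop

@[fun_prop]
theorem DefP.isOPair (hf : DefF f) (hg : DefF g) (hh : DefF h) :
    DefP fun v => IsOPair (f v) (g v) (h v) := by
  simp only [IsOPair]; fun_prop

@[fun_prop]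
theorem DefP.app (hf : DefF f) (hg : DefF g) (hh : DefF h) :
    DefP fun v => App (f v) (g v) (h v) := by
  simp only [App]; fun_prop

@[fun_prop]
theorem DefF.ap (hf : DefF f) (hg : DefF g) : DefF fun v => ap (f v) (g v) := by
  unfold ZFSetTheory.ap; fun_prop

@[fun_prop]
theorem DefP.isFun (hf : DefF f) (hg : DefF g) (hh : DefF h) :
    DefP fun v => IsFun (f v) (g v) (h v) := by
  simp only [IsFun, forall_iff_not_exists, imp_iff_not_or]; fun_prop

@[fun_prop]
theorem DefP.isSurj (hf : DefF f) (hg : DefF g) (hh : DefF h) :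
    DefP fun v => IsSurj (f v) (g v) (h v) := by
  simp only [IsSurj, forall_iff_not_exists, imp_iff_not_or]; fun_prop

@[fun_prop]
theorem DefP.isTrans (hf : DefF f) : DefP fun v => IsTrans (f v) := by
  simp only [IsTrans, forall_iff_not_exists, imp_iff_not_or]; fun_prop

@[fun_prop]
theorem DefP.isOrd (hf : DefF f) : DefP fun v => IsOrd (f v) := by
  simp only [IsOrd, forall_iff_not_exists, imp_iff_not_or]; fun_prop

end Definability

/-! ### Elementary set theory -/

variable [M ⊨ ZF]

theorem realize_axiom {φ : setLang.Sentence} (h : φ ∈ ({extensionality, foundation, pairing, union,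
    powerSet, infinity} : Set setLang.Sentence)) : M ⊨ φ :=
  Theory.realize_sentence_of_mem ZF (Or.inl (Or.inl h))

theorem mem_ext {x y : M} (h : ∀ z, Mem z x ↔ Mem z y) : x = y :=
  realize_extensionality.1 (realize_axiom (by simp)) x y h

theorem mem_cls {P : M → Prop} (h : ∃ b, ∀ x, Mem x b ↔ P x) {x : M} : Mem x (cls P) ↔ P x := by
  obtain ⟨b, hb⟩ := h
  rw [cls, the_eq (y := b), hb]
  refine fun z => ⟨fun hz => mem_ext fun x => (hz x).trans (hb x).symm, ?_⟩
  rintro rfl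
  exact hb

theorem mem_cls_of_bound {P : M → Prop} (hP : DefP P) (a : M) (ha : ∀ x, P x → Mem x a) {x : M} :
    Mem x (cls P) ↔ P x := by
  refine mem_cls ?_
  obtain ⟨b, hb⟩ := exists_sep hP a
  exact ⟨b, fun x => (hb x).trans (and_iff_right_of_imp (ha x))⟩

@[simp]
theorem mem_pr {a b x : M} : Mem x (pr a b) ↔ x = a ∨ x = b :=
  mem_cls (realize_pairing.1 (realize_axiom (by simp)) a b)

@[simp]
theorem mem_sUnion {a x : M} : Mem x (sUnion a) ↔ ∃ y, Mem y a ∧ Mem x y :=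
  mem_cls (realize_union.1 (realize_axiom (by simp)) a)

@[simp]
theorem mem_pow {a x : M} : Mem x (pow a) ↔ Sub x a :=
  mem_cls (realize_powerSet.1 (realize_axiom (by simp)) a)

theorem mem_sep {a x : M} {P : M → Prop} (hP : DefP P) : Mem x (sep a P) ↔ Mem x a ∧ P x :=
  mem_cls (exists_sep hP a)

theorem mem_img {a y : M} {f : M → M} (hf : DefF f) :
    Mem y (img a f) ↔ ∃ x, Mem x a ∧ y = f x :=
  mem_cls (exists_image hf a)

@[simp]
theorem mem_succ {a x : M} : Mem x (succ a) ↔ Mem x a ∨ x = a :=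
  mem_cls ⟨sUnion (pr a (pr a a)), fun x => by simp⟩

theorem isPair_iff {c a b : M} : IsPair c a b ↔ c = pr a b :=
  ⟨fun h => mem_ext fun z => (h z).trans mem_pr.symm, fun h _ => h ▸ mem_pr⟩

theorem isOPair_iff {p a b : M} : IsOPair p a b ↔ p = opr a b := by
  simp [IsOPair, isPair_iff, opr]

theorem app_iff {f x y : M} : App f x y ↔ Mem (opr x y) f := by
  simp [App, isOPair_iff]

theorem pr_eq_self_iff {a b c : M} : pr a a = pr b c ↔ b = a ∧ c = a := by
  refine ⟨fun h => ?_, fun ⟨h, h'⟩ => by rw [h, h']⟩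
  have h1 : Mem b (pr a a) := h ▸ mem_pr.2 (Or.inl rfl)
  have h2 : Mem c (pr a a) := h ▸ mem_pr.2 (Or.inr rfl)
  simpa using And.intro h1 h2

theorem opr_inj {a b c d : M} : opr a b = opr c d ↔ a = c ∧ b = d := by
  refine ⟨fun h => ?_, fun ⟨h, h'⟩ => by rw [h, h']⟩
  have hac : a = c := by
    have h1 : Mem (pr a a) (opr c d) := h ▸ mem_pr.2 (Or.inl rfl)
    rcases mem_pr.1 h1 with h1 | h1
    · exact (pr_eq_self_iff.1 h1).1.symm
    · exact (pr_eq_self_iff.1 h1).1.symm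
  subst hac
  refine ⟨rfl, ?_⟩
  have h1 : Mem (pr a b) (opr a d) := h ▸ mem_pr.2 (Or.inr rfl)
  have h2 : Mem (pr a d) (opr a b) := h ▸ mem_pr.2 (Or.inr rfl)
  rcases mem_pr.1 h1 with h1 | h1
  · obtain rfl := (pr_eq_self_iff.1 h1.symm).2
    rcases mem_pr.1 h2 with h2 | h2 <;> exact (pr_eq_self_iff.1 h2.symm).2.symm
  · have h3 : Mem b (pr a d) := h1 ▸ mem_pr.2 (Or.inr rfl)
    have h4 : Mem d (pr a b) := h1 ▸ mem_pr.2 (Or.inr rfl)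
    rcases mem_pr.1 h3 with h3 | h3
    · rcases mem_pr.1 h4 with h4 | h4
      · rw [h3, h4]
      · exact h4.symm
    · exact h3

theorem pr_comm (a b : M) : pr a b = pr b a := mem_ext fun _ => by simp [or_comm]

theorem mem_prod {a b p : M} : Mem p (prod a b) ↔ ∃ x, Mem x a ∧ ∃ y, Mem y b ∧ p = opr x y := by
  -- Replacement used twice bounds the product: the union of the slices `{x} × b` for `x ∈ a`.
  refine mem_cls_of_bound (by fun_prop) (sUnion (img a fun x => img b fun y => opr x y)) ?_
  rintro p ⟨x, hx, y, hy, rfl⟩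
  rw [mem_sUnion]
  refine ⟨img b fun y => opr x y, (mem_img (by fun_prop)).2 ⟨x, hx, rfl⟩, ?_⟩
  exact (mem_img (by fun_prop)).2 ⟨y, hy, rfl⟩

theorem mem_pairs {a z : M} :
    Mem z (pairs a) ↔ ∃ x, Mem x a ∧ ∃ y, Mem y a ∧ x ≠ y ∧ z = pr x y := by
  refine mem_cls_of_bound (by fun_prop) (pow a) ?_
  rintro _ ⟨x, hx, y, hy, -, rfl⟩
  rw [mem_pow]
  intro z hz
  rcases mem_pr.1 hz with rfl | rfl <;> assumption

theorem isPairs_iff {P X : M} : IsPairs P X ↔ P = pairs X := by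
  simp only [IsPairs, isPair_iff, ← mem_pairs]
  exact ⟨mem_ext, fun h z => h ▸ Iff.rfl⟩

theorem img_congr {a : M} {f g : M → M} (h : ∀ x, Mem x a → f x = g x) : img a f = img a g := by
  have : ∀ y, (∃ x, Mem x a ∧ y = f x) ↔ ∃ x, Mem x a ∧ y = g x := fun y =>
    exists_congr fun x => and_congr_right fun hx => by rw [h x hx]
  simp only [img, this]

/-! ### Functions -/

theorem app_lam {f : M → M} (hf : DefF f) {a x y : M} :
    App (lam a f) x y ↔ Mem x a ∧ y = f x := by
  rw [app_iff, lam, mem_img (by fun_prop)]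
  simp only [opr_inj]
  constructor
  · rintro ⟨x, hx, rfl, rfl⟩
    exact ⟨hx, rfl⟩
  · exact fun ⟨hx, hy⟩ => ⟨x, hx, rfl, hy⟩

theorem ap_eq_of_app {f x y : M} (h : App f x y) (h' : ∀ z, App f x z → z = y) : ap f x = y :=
  the_eq fun z => ⟨h' z, fun e => e ▸ h⟩

theorem ap_lam {f : M → M} (hf : DefF f) {a x : M} (hx : Mem x a) : ap (lam a f) x = f x :=
  ap_eq_of_app ((app_lam hf).2 ⟨hx, rfl⟩) fun _ hz => ((app_lam hf).1 hz).2

theorem isFun_lam {f : M → M} (hf : DefF f) {a b : M} (h : ∀ x, Mem x a → Mem (f x) b) :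
    IsFun (lam a f) a b := by
  refine ⟨fun p hp => ?_, fun x hx => ⟨f x, (app_lam hf).2 ⟨hx, rfl⟩,
    fun z hz => ((app_lam hf).1 hz).2⟩⟩
  obtain ⟨x, hx, rfl⟩ := (mem_img (by fun_prop)).1 hp
  exact ⟨x, hx, f x, h x hx, isOPair_iff.2 rfl⟩

theorem IsFun.app_ap {f X Y x : M} (h : IsFun f X Y) (hx : Mem x X) : App f x (ap f x) := by
  obtain ⟨y, hy, hz⟩ := h.2 x hx
  rwa [ap_eq_of_app hy hz]

theorem IsFun.dom_cod {f X Y x y : M} (h : IsFun f X Y) (hxy : App f x y) : Mem x X ∧ Mem y Y := by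
  obtain ⟨x', hx, y', hy, hp⟩ := h.1 _ (app_iff.1 hxy)
  obtain ⟨rfl, rfl⟩ := opr_inj.1 (isOPair_iff.1 hp)
  exact ⟨hx, hy⟩

theorem IsFun.app_iff {f X Y x y : M} (h : IsFun f X Y) : App f x y ↔ Mem x X ∧ y = ap f x := by
  refine ⟨fun hxy => ⟨(h.dom_cod hxy).1, ?_⟩, fun ⟨hx, hy⟩ => hy ▸ h.app_ap hx⟩
  obtain ⟨z, _, hz⟩ := h.2 x (h.dom_cod hxy).1
  rw [hz y hxy, hz _ (h.app_ap (h.dom_cod hxy).1)]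

theorem IsFun.ap_mem {f X Y x : M} (h : IsFun f X Y) (hx : Mem x X) : Mem (ap f x) Y :=
  (h.dom_cod (h.app_ap hx)).2

theorem IsFun.sub_prod {f X Y : M} (h : IsFun f X Y) : Sub f (prod X Y) := fun p hp => by
  obtain ⟨x, hx, y, hy, e⟩ := h.1 p hp
  exact mem_prod.2 ⟨x, hx, y, hy, isOPair_iff.1 e⟩

theorem isSurj_iff {f X Y : M} :
    IsSurj f X Y ↔ IsFun f X Y ∧ ∀ y, Mem y Y → ∃ x, Mem x X ∧ ap f x = y := by
  refine and_congr_right fun h => forall₂_congr fun y _ => exists_congr fun x => ?_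
  rw [h.app_iff]
  exact ⟨fun ⟨hx, _, e⟩ => ⟨hx, e.symm⟩, fun ⟨hx, e⟩ => ⟨hx, hx, e.symm⟩⟩

theorem isBij_iff {f X Y : M} : IsBij f X Y ↔ IsSurj f X Y ∧
    ∀ x, Mem x X → ∀ x', Mem x' X → ap f x = ap f x' → x = x' := by
  refine and_congr_right fun h => ?_
  simp only [h.1.app_iff]
  exact ⟨fun H x hx x' hx' e => H x x' _ ⟨hx, rfl⟩ ⟨hx', e⟩,
    fun H x x' y ⟨hx, e⟩ ⟨hx', e'⟩ => H x hx x' hx' (e.symm.trans e')⟩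

/-- Values outside `Y` are redirected to `y₀`, so `f` need only hit every element of `Y`. It may be
junk elsewhere on `X`. -/
theorem exists_isSurj {f : M → M} (hf : DefF f) {X Y y₀ : M} (h0 : Mem y₀ Y)
    (h : ∀ y, Mem y Y → ∃ x, Mem x X ∧ f x = y) : ∃ g, IsSurj g X Y := by
  classical
  have hd : DefF fun x => if Mem (f x) Y then f x else y₀ := by fun_prop
  refine ⟨lam X fun x => if Mem (f x) Y then f x else y₀, isSurj_iff.2
    ⟨isFun_lam hd fun x _ => ?_, fun y hy => ?_⟩⟩
  · split_ifs with hx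
    exacts [hx, h0]
  · obtain ⟨x, hx, rfl⟩ := h y hy
    exact ⟨x, hx, by rw [ap_lam hd hx, if_pos hy]⟩

theorem equinum_of {f : M → M} (hf : DefF f) {X Y : M} (h : ∀ x, Mem x X → Mem (f x) Y)
    (hs : ∀ y, Mem y Y → ∃ x, Mem x X ∧ f x = y)
    (hi : ∀ x, Mem x X → ∀ x', Mem x' X → f x = f x' → x = x') : Equinum X Y := by
  refine ⟨lam X f, isBij_iff.2 ⟨isSurj_iff.2 ⟨isFun_lam hf h, fun y hy => ?_⟩,
    fun x hx x' hx' e => ?_⟩⟩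
  · obtain ⟨x, hx, e⟩ := hs y hy
    exact ⟨x, hx, by rw [ap_lam hf hx, e]⟩
  · rw [ap_lam hf hx, ap_lam hf hx'] at e
    exact hi x hx x' hx' e

theorem Equinum.symm {X Y : M} (h : Equinum X Y) : Equinum Y X := by
  obtain ⟨f, hf⟩ := h
  obtain ⟨hs, hi⟩ := isBij_iff.1 hf
  obtain ⟨hf, hs⟩ := isSurj_iff.1 hs
  have key : ∀ x, Mem x X → the (fun x' => Mem x' X ∧ ap f x' = ap f x) = x := fun x hx =>
    the_eq fun z => ⟨fun ⟨hz, e⟩ => hi z hz x hx e, by rintro rfl; exact ⟨hx, rfl⟩⟩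
  refine equinum_of (f := fun y => the fun x' => Mem x' X ∧ ap f x' = y) (by fun_prop) ?_ ?_ ?_
  · intro y hy
    obtain ⟨x, hx, rfl⟩ := hs y hy
    rwa [key x hx]
  · exact fun x hx => ⟨ap f x, hf.ap_mem hx, key x hx⟩
  · intro y hy y' hy' e
    obtain ⟨x, hx, rfl⟩ := hs y hy
    obtain ⟨x', hx', rfl⟩ := hs y' hy'
    rw [key x hx, key x' hx'] at e
    rw [e]

theorem Equinum.trans {X Y Z : M} (h : Equinum X Y) (h' : Equinum Y Z) : Equinum X Z := by
  obtain ⟨f, hf⟩ := h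
  obtain ⟨hs, hi⟩ := isBij_iff.1 hf
  obtain ⟨hf, hs⟩ := isSurj_iff.1 hs
  obtain ⟨g, hg⟩ := h'
  obtain ⟨gs, gi⟩ := isBij_iff.1 hg
  obtain ⟨hg, gs⟩ := isSurj_iff.1 gs
  refine equinum_of (f := fun x => ap g (ap f x)) (by fun_prop)
    (fun x hx => hg.ap_mem (hf.ap_mem hx)) ?_
    fun x hx x' hx' e => hi x hx x' hx' (gi _ (hf.ap_mem hx) _ (hf.ap_mem hx') e)
  intro z hz
  obtain ⟨y, hy, rfl⟩ := gs z hz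
  obtain ⟨x, hx, rfl⟩ := hs y hy
  exact ⟨x, hx, rfl⟩

theorem img_equinum {f : M → M} (hf : DefF f) {X : M}
    (hi : ∀ x, Mem x X → ∀ x', Mem x' X → f x = f x' → x = x') : Equinum (img X f) X := by
  refine (equinum_of hf (fun x hx => (mem_img hf).2 ⟨x, hx, rfl⟩) (fun y hy => ?_) hi).symm
  obtain ⟨x, hx, rfl⟩ := (mem_img hf).1 hy
  exact ⟨x, hx, rfl⟩

theorem constOn_iff {f X Y D : M} (hf : IsFun f X Y) (hD : Sub D X) :
    ConstOn f D ↔ ∀ x, Mem x D → ∀ y, Mem y D → ap f x = ap f y := by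
  simp only [ConstOn, hf.app_iff]
  exact ⟨fun H x hx y hy => H x hx y hy _ _ ⟨hD x hx, rfl⟩ ⟨hD y hy, rfl⟩,
    fun H x hx y hy a b ⟨_, ha⟩ ⟨_, hb⟩ => by rw [ha, hb, H x hx y hy]⟩

/-! ### Ordinals -/

theorem mem_irrefl (x : M) : ¬ Mem x x := fun h => by
  obtain ⟨y, hy, hn⟩ := realize_foundation.1 (realize_axiom (by simp)) (pr x x)
    ⟨x, mem_pr.2 (Or.inl rfl)⟩
  obtain rfl : y = x := by simpa using hy
  exact hn ⟨y, h, hy⟩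

theorem IsOrd.mem {a b : M} (ha : IsOrd a) (h : Mem b a) : IsOrd b :=
  ⟨ha.2 b h, fun c hc => ha.2 c (ha.1 b h c hc)⟩

theorem IsOrd.trans {a b c : M} (ha : IsOrd a) (hb : Mem b a) (hc : Mem c b) : Mem c a :=
  ha.1 b hb c hc

theorem isOrd_succ {a : M} (ha : IsOrd a) : IsOrd (succ a) := by
  refine ⟨fun y hy z hz => mem_succ.2 (Or.inl ?_), fun y hy => ?_⟩
  · rcases mem_succ.1 hy with hy | rfl
    · exact ha.trans hy hz
    · exact hz
  · rcases mem_succ.1 hy with hy | rfl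
    · exact ha.2 y hy
    · exact ha.1

/-- Foundation applied to the part of `a ∪ {a}` where `P` holds. Transitivity puts every element of
the minimal `b` back in `a ∪ {a}`, so minimality there is minimality outright. -/
theorem exists_least_ord {P : M → Prop} (hP : DefP P) {a : M} (ha : IsOrd a) (h : P a) :
    ∃ b, IsOrd b ∧ P b ∧ ∀ c, Mem c b → ¬ P c := by
  obtain ⟨b, hb, hmin⟩ := realize_foundation.1 (realize_axiom (by simp)) (sep (succ a) P)
    ⟨a, (mem_sep hP).2 ⟨mem_succ.2 (Or.inr rfl), h⟩⟩
  obtain ⟨hba, hPb⟩ := (mem_sep hP).1 hb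
  exact ⟨b, (isOrd_succ ha).mem hba, hPb, fun c hc hPc =>
    hmin ⟨c, hc, (mem_sep hP).2 ⟨(isOrd_succ ha).trans hba hc, hPc⟩⟩⟩

theorem ord_induction {P : M → Prop} (hP : DefP P)
    (h : ∀ a, IsOrd a → (∀ b, Mem b a → P b) → P a) {a : M} (ha : IsOrd a) : P a := by
  by_contra hn
  obtain ⟨b, hb, hPb, hmin⟩ := exists_least_ord hP.not ha hn
  exact hPb (h b hb fun c hc => not_not.1 (hmin c hc))

theorem ord_trichotomy {a b : M} (ha : IsOrd a) (hb : IsOrd b) :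
    Mem a b ∨ a = b ∨ Mem b a := by
  suffices H : ∀ b, IsOrd b → Mem a b ∨ a = b ∨ Mem b a from H b hb
  refine ord_induction (P := fun a => ∀ b, IsOrd b → Mem a b ∨ a = b ∨ Mem b a) ?_ ?_ ha
  · simp only [forall_iff_not_exists, imp_iff_not_or]
    fun_prop
  intro a ha iha b hb
  refine ord_induction (P := fun b => Mem a b ∨ a = b ∨ Mem b a) (by fun_prop) ?_ hb
  intro b hb ihb
  by_contra! hn
  -- If `a` and `b` were incomparable, the two induction hypotheses would give them the same
  -- elements.
  refine hn.2.1 (mem_ext fun z => ⟨fun hz => ?_, fun hz => ?_⟩)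
  · rcases iha z hz b hb with h | rfl | h
    · exact h
    · exact absurd hz hn.2.2
    · exact absurd (ha.trans hz h) hn.2.2
  · rcases ihb z hz with h | rfl | h
    · exact absurd (hb.trans hz h) hn.1
    · exact absurd hz hn.1
    · exact h

/-- The least ordinal satisfying `P`. -/
noncomputable def leastOrd (P : M → Prop) : M :=
  the fun b => IsOrd b ∧ P b ∧ ∀ c, Mem c b → ¬ P c

@[fun_prop]
theorem DefF.leastOrd {P : Γ → M → Prop} (hP : DefP fun w : Γ × M => P w.1 w.2) :
    DefF fun v => leastOrd (P v) := by
  refine DefF.the ?_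
  simp only [forall_iff_not_exists, imp_iff_not_or]
  fun_prop

theorem leastOrd_eq {P : M → Prop} {b : M} (hb : IsOrd b) (hPb : P b)
    (hmin : ∀ c, Mem c b → ¬ P c) : leastOrd P = b := by
  refine the_eq fun z => ⟨fun ⟨hz, hPz, hz'⟩ => ?_, by rintro rfl; exact ⟨hb, hPb, hmin⟩⟩
  rcases ord_trichotomy hz hb with h | h | h
  · exact absurd hPz (hmin z h)
  · exact h
  · exact absurd hPb (hz' b h)

theorem leastOrd_spec {P : M → Prop} (hP : DefP P) {a : M} (ha : IsOrd a) (h : P a) :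
    IsOrd (leastOrd P) ∧ P (leastOrd P) ∧ ∀ c, Mem c (leastOrd P) → ¬ P c := by
  obtain ⟨b, hb, hPb, hmin⟩ := exists_least_ord hP ha h
  rw [leastOrd_eq hb hPb hmin]
  exact ⟨hb, hPb, hmin⟩

/-! ### Transfinite recursion -/

/-- `g` satisfies the recursion `g(η) = G(p, g[η])` for all `η < ξ`. -/
def Attempt (G : M → M → M) (p g ξ : M) : Prop :=
  ∀ η, Mem η ξ → ap g η = G p (img η (ap g))

/-- The function `F` with `F(p, ξ) = G(p, {F(p, η) | η < ξ})`. -/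
noncomputable def recF (G : M → M → M) (p ξ : M) : M :=
  the fun y => ∃ g, Attempt G p g ξ ∧ y = G p (img ξ (ap g))

section Recursion

variable {G : M → M → M} (hG : DefF fun w : M × M => G w.1 w.2)
include hG

@[fun_prop]
theorem DefP.attempt {f g h : Γ → M} (hf : DefF f) (hg : DefF g) (hh : DefF h) :
    DefP fun v => Attempt G (f v) (g v) (h v) := by
  simp only [Attempt, forall_iff_not_exists, imp_iff_not_or]
  fun_prop

@[fun_prop]
theorem DefF.recF {f g : Γ → M} (hf : DefF f) (hg : DefF g) :
    DefF fun v => recF G (f v) (g v) := by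
  have := fun {f g h : Γ × M × M → M} => DefP.attempt hG (f := f) (g := g) (h := h)
  unfold ZFSetTheory.recF
  fun_prop

theorem recF_eq {p ξ : M} (hξ : IsOrd ξ) : recF G p ξ = G p (img ξ (recF G p)) := by
  have dR : DefF (recF G p) := DefF.recF hG (DefF.const p) DefF.id
  -- Two attempts agree below `ξ`, so the value in the definition of `recF` does not depend on the
  -- attempt.
  have uniq : ∀ {g g' : M}, ∀ ξ, IsOrd ξ → Attempt G p g ξ → Attempt G p g' ξ →
      ∀ η, IsOrd η → Mem η ξ → ap g η = ap g' η := by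
    intro g g' ξ hξ h h' η hη
    refine ord_induction (P := fun η => Mem η ξ → ap g η = ap g' η)
      (DefP.imp (by fun_prop) (by fun_prop)) (fun η _ ih hηξ => ?_) hη
    rw [h η hηξ, h' η hηξ, img_congr fun ζ hζ => ih ζ hζ (hξ.trans hηξ hζ)]
  have val : ∀ {g : M} ξ, IsOrd ξ → Attempt G p g ξ → recF G p ξ = G p (img ξ (ap g)) := by
    refine fun {g} ξ hξ h => the_eq fun y => ⟨?_, fun e => ⟨g, h, e⟩⟩
    rintro ⟨g', h', rfl⟩
    rw [img_congr fun η hη => uniq ξ hξ h' h η (hξ.mem hη) hη]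
  -- The attempt of length `ξ` is `recF` itself restricted to `ξ`. By induction its restrictions to
  -- smaller ordinals are attempts, and `val` evaluates it.
  have ex : ∀ ξ, IsOrd ξ → Attempt G p (lam ξ (recF G p)) ξ := by
    refine fun ξ hξ => ord_induction (P := fun ξ => Attempt G p (lam ξ (recF G p)) ξ)
      (DefP.attempt hG (by fun_prop) ?_ (by fun_prop)) (fun ξ hξ ih η hη => ?_) hξ
    · exact DefF.lam DefF.id (DefF.comp dR DefF.snd_proj)
    · have hη' := hξ.mem hη
      rw [ap_lam dR hη, val η hη' (ih η hη)]
      refine congrArg _ (img_congr fun ζ hζ => ?_)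
      rw [ap_lam dR hζ, ap_lam dR (hξ.trans hη hζ)]
  have h := ex ξ hξ
  rw [val ξ hξ h, img_congr fun η hη => ap_lam dR hη]

end Recursion

/-! ### Greedy sequences -/

/-- `β` is a possible `ξ`-th term of a sequence with terms `F(p, η)` for `η < ξ`. -/
def Adm (A : M → M → Prop) (R : M → M → M → Prop) (F : M → M → M) (p ξ β : M) : Prop :=
  A p β ∧ ∀ η, Mem η ξ → R p β (F p η)

/-- The sequence whose `ξ`-th term is the least possible one. -/
noncomputable def greedy (A : M → M → Prop) (R : M → M → M → Prop) : M → M → M :=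
  recF fun p S => leastOrd fun β => A p β ∧ ∀ γ, Mem γ S → R p β γ

section Greedy

variable {A : M → M → Prop} {R : M → M → M → Prop} (hA : DefP fun w : M × M => A w.1 w.2)
  (hR : DefP fun w : M × M × M => R w.1 w.2.1 w.2.2)
include hA hR

theorem greedy_step_definable : DefF fun w : M × M => leastOrd fun β =>
    A w.1 β ∧ ∀ γ, Mem γ w.2 → R w.1 β γ := by
  refine DefF.leastOrd (DefP.and ?_ (DefP.all (DefP.imp (by fun_prop) ?_)))
  · exact hA.comp (f := fun w : (M × M) × M => (w.1.1, w.2)) (by fun_prop)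
  · exact hR.comp (f := fun w : ((M × M) × M) × M => (w.1.1.1, w.1.2, w.2)) (by fun_prop)

@[fun_prop]
theorem DefF.greedy {f g : Γ → M} (hf : DefF f) (hg : DefF g) :
    DefF fun v => greedy A R (f v) (g v) :=
  DefF.recF (greedy_step_definable hA hR) hf hg

theorem greedy_eq {p ξ : M} (hξ : IsOrd ξ) :
    greedy A R p ξ = leastOrd (Adm A R (greedy A R) p ξ) := by
  have h := recF_eq (G := fun p S => leastOrd fun β => A p β ∧ ∀ γ, Mem γ S → R p β γ)
    (greedy_step_definable hA hR) (p := p) hξ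
  have hd : DefF (greedy A R p) := DefF.greedy hA hR (DefF.const p) DefF.id
  refine h.trans (congrArg leastOrd (funext fun β => propext (and_congr_right fun _ => ?_)))
  change (∀ γ, Mem γ (img ξ (greedy A R p)) → _) ↔ _
  simp only [mem_img hd]
  exact ⟨fun H η hη => H _ ⟨η, hη, rfl⟩, fun H γ ⟨η, hη, e⟩ => e ▸ H η hη⟩

theorem DefP.adm (p ξ : M) : DefP (Adm A R (greedy A R) p ξ) := by
  refine DefP.and ?_ (DefP.all (DefP.imp (by fun_prop) ?_))
  · exact hA.comp (f := fun w : M => (p, w)) (by fun_prop)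
  · exact hR.comp (f := fun w : M × M => (p, w.1, greedy A R p w.2))
      (by have := fun {f g : M × M → M} => DefF.greedy hA hR (f := f) (g := g); fun_prop)

theorem greedy_spec {p ξ β : M} (hξ : IsOrd ξ) (hβ : IsOrd β)
    (h : Adm A R (greedy A R) p ξ β) :
    IsOrd (greedy A R p ξ) ∧ Adm A R (greedy A R) p ξ (greedy A R p ξ) ∧
      ∀ γ, Mem γ (greedy A R p ξ) → ¬ Adm A R (greedy A R) p ξ γ := by
  rw [greedy_eq hA hR hξ]
  exact leastOrd_spec (DefP.adm hA hR p ξ) hβ h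

/-- A greedy sequence that leaves the ordinal `b` passes through `b`, if `b` is always possible. -/
theorem greedy_hits {p b ξ : M} (hb : IsOrd b) (hAb : A p b) (hRb : ∀ γ, Mem γ b → R p b γ)
    (hξ : IsOrd ξ) (h : ¬ Mem (greedy A R p ξ) b) :
    ∃ η, Mem η (succ ξ) ∧ greedy A R p η = b ∧ ∀ ζ, Mem ζ η → Mem (greedy A R p ζ) b := by
  have hd : DefF (greedy A R p) := DefF.greedy hA hR (DefF.const p) DefF.id
  -- Take the first exit from `b`, possibly at `ξ` itself, hence the bound `succ ξ`. All earlier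
  -- terms lie in `b`, so `b` is admissible there. The least admissible ordinal is then at most `b`,
  -- and not below it.
  obtain ⟨η, hη, ⟨hηξ, hn⟩, hmin⟩ := exists_least_ord
    (P := fun η => Mem η (succ ξ) ∧ ¬ Mem (greedy A R p η) b) (by fun_prop) hξ
    ⟨mem_succ.2 (Or.inr rfl), h⟩
  have hlow : ∀ ζ, Mem ζ η → Mem (greedy A R p ζ) b := fun ζ hζ => by
    by_contra hc
    exact hmin ζ hζ ⟨(isOrd_succ hξ).trans hηξ hζ, hc⟩
  have hadm : Adm A R (greedy A R) p η b := ⟨hAb, fun ζ hζ => hRb _ (hlow ζ hζ)⟩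
  obtain ⟨ho, _, hm⟩ := greedy_spec hA hR hη hb hadm
  refine ⟨η, hηξ, ?_, hlow⟩
  rcases ord_trichotomy ho hb with hc | hc | hc
  · exact absurd hc hn
  · exact hc
  · exact absurd hadm (hm b hc)

/-- As long as earlier terms stay in `b`, `b` is a candidate, so the next term is a genuine minimum
and not the default value of `the`. -/
theorem greedy_adm {p b η : M} (hb : IsOrd b) (hAb : A p b) (hRb : ∀ γ, Mem γ b → R p b γ)
    (hη : IsOrd η) (h : ∀ ζ, Mem ζ η → Mem (greedy A R p ζ) b) :
    Adm A R (greedy A R) p η (greedy A R p η) :=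
  (greedy_spec hA hR hη hb ⟨hAb, fun ζ hζ => hRb _ (h ζ hζ)⟩).2.1

theorem greedy_injOn {p κ : M} (hκ : IsOrd κ) (hRm : ∀ β γ, R p β γ → Mem γ β)
    (h : ∀ ξ, Mem ξ κ → Adm A R (greedy A R) p ξ (greedy A R p ξ)) {x x' : M} (hx : Mem x κ)
    (hx' : Mem x' κ) (e : greedy A R p x = greedy A R p x') : x = x' := by
  rcases ord_trichotomy (hκ.mem hx) (hκ.mem hx') with hc | hc | hc
  · exact absurd (e ▸ hRm _ _ ((h x' hx').2 x hc)) (mem_irrefl _)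
  · exact hc
  · exact absurd (e ▸ hRm _ _ ((h x hx).2 x' hc)) (mem_irrefl _)

end Greedy

/-! ### The ordinal `h(X)` -/

/-- A surjection `f : X → b` onto an ordinal induces the relation `f x ∈ f y` on `X`, which
determines `b` as its collapse. Replacement over the power set of `X × X` therefore bounds all such
`b`, and the required ordinal is the set of these `b` together with `∅`. -/
theorem exists_isH (X : M) : ∃ a, IsH a X := by
  have hb : ∃ B : M, ∀ b, IsOrd b → (∃ f, IsSurj f X b) → Mem b B := by
    let Q : M → M → Prop := fun r b => IsOrd b ∧ ∃ f, IsSurj f X b ∧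
      r = sep (prod X X) fun p => ∃ x y, p = opr x y ∧ Mem (ap f x) (ap f y)
    have dQ : DefP fun w : M × M => Q w.1 w.2 := by
      simp only [Q, sep]
      fun_prop
    have dF : DefF fun r => the (Q r) := DefF.the dQ
    obtain ⟨B, hB⟩ := exists_image dF (pow (prod X X))
    refine ⟨B, fun b hb ⟨f, hf⟩ => (hB b).2 ⟨sep (prod X X) fun p => ∃ x y, p = opr x y ∧
      Mem (ap f x) (ap f y), mem_pow.2 fun p hp => ((mem_sep (by fun_prop)).1 hp).1, Eq.symm ?_⟩⟩
    refine the_eq fun c => ⟨?_, by rintro rfl; exact ⟨hb, f, hf, rfl⟩⟩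
    rintro ⟨hc, g, hg, e⟩
    obtain ⟨hf, fs⟩ := isSurj_iff.1 hf
    obtain ⟨hg, gs⟩ := isSurj_iff.1 hg
    have key : ∀ x, Mem x X → ∀ y, Mem y X →
        (Mem (ap f x) (ap f y) ↔ Mem (ap g x) (ap g y)) := by
      intro x hx y hy
      have h := congrArg (Mem (opr x y)) e
      rw [eq_iff_iff, mem_sep (by fun_prop), mem_sep (by fun_prop)] at h
      have hp : Mem (opr x y) (prod X X) := mem_prod.2 ⟨x, hx, y, hy, rfl⟩
      have aux : ∀ k : M, (Mem (opr x y) (prod X X) ∧ ∃ x' y', opr x y = opr x' y' ∧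
          Mem (ap k x') (ap k y')) ↔ Mem (ap k x) (ap k y) := by
        refine fun k => ⟨?_, fun h => ⟨hp, x, y, rfl, h⟩⟩
        rintro ⟨-, x', y', e, h⟩
        obtain ⟨rfl, rfl⟩ := opr_inj.1 e
        exact h
      exact (aux f).symm.trans (h.trans (aux g))
    -- Uniqueness of the collapse, by induction on the value: both maps send `x` to the set of
    -- values at the predecessors of `x`.
    have heq : ∀ d, IsOrd d → ∀ x, Mem x X → ap f x = d → ap g x = d := by
      intro d hd
      refine ord_induction (P := fun d => ∀ x, Mem x X → ap f x = d → ap g x = d) ?_ ?_ hd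
      · simp only [forall_iff_not_exists, imp_iff_not_or]
        fun_prop
      rintro _ - ih x hx rfl
      refine mem_ext fun z => ⟨fun hz => ?_, fun hz => ?_⟩
      · obtain ⟨y, hy, rfl⟩ := gs z (hc.trans (hg.ap_mem hx) hz)
        have h := (key y hy x hx).2 hz
        rwa [ih _ h y hy rfl]
      · obtain ⟨y, hy, rfl⟩ := fs z (hb.trans (hf.ap_mem hx) hz)
        rw [← ih _ hz y hy rfl]
        exact (key y hy x hx).1 hz
    have hfg : ∀ x, Mem x X → ap g x = ap f x := fun x hx =>
      heq _ (hb.mem (hf.ap_mem hx)) x hx rfl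
    refine mem_ext fun z => ⟨fun hz => ?_, fun hz => ?_⟩
    · obtain ⟨x, hx, rfl⟩ := gs z hz
      rw [hfg x hx]
      exact hf.ap_mem hx
    · obtain ⟨x, hx, rfl⟩ := fs z hz
      rw [← hfg x hx]
      exact hg.ap_mem hx
  obtain ⟨B, hB⟩ := hb
  obtain ⟨H, hH⟩ : ∃ H : M, ∀ b, Mem b H ↔ IsOrd b ∧ ((∃ y, Mem y b) → ∃ f, IsSurj f X b) := by
    obtain ⟨H, hH⟩ := exists_sep (P := fun b => IsOrd b ∧ ((∃ y, Mem y b) → ∃ f, IsSurj f X b))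
      (DefP.and (by fun_prop) (DefP.imp (by fun_prop) (by fun_prop)))
      -- The power set supplies `∅`, which need not lie in `B`.
      (sUnion (pr B (pow (cls fun _ => False))))
    refine ⟨H, fun b => (hH b).trans (and_iff_right_of_imp fun ⟨hb, hs⟩ => ?_)⟩
    simp only [mem_sUnion, mem_pr, exists_eq_or_imp, exists_eq_left, mem_pow]
    by_cases hn : ∃ y, Mem y b
    · exact Or.inl (hB b hb (hs hn))
    · exact Or.inr fun y hy => absurd ⟨y, hy⟩ hn
  have hHo : IsOrd H := by
    refine ⟨fun b hb c hc => ?_, fun b hb => ((hH b).1 hb).1.1⟩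
    obtain ⟨hbo, hs⟩ := (hH b).1 hb
    obtain ⟨f, hf⟩ := hs ⟨c, hc⟩
    refine (hH c).2 ⟨hbo.mem hc, fun ⟨y, hy⟩ => ?_⟩
    refine exists_isSurj (f := ap f) (by fun_prop) hy fun z hz => ?_
    exact (isSurj_iff.1 hf).2 z (hbo.trans hc hz)
  obtain ⟨e, he⟩ : ∃ e : M, ∀ x, ¬ Mem x e := by
    obtain ⟨e, he⟩ := exists_sep (DefP.const (Γ := M) False) (Classical.arbitrary M)
    exact ⟨e, fun x hx => ((he x).1 hx).2⟩
  have h0 : Mem e H := (hH e).2 ⟨⟨fun y hy => absurd hy (he y), fun y hy => absurd hy (he y)⟩,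
    fun ⟨y, hy⟩ => absurd hy (he y)⟩
  exact ⟨H, hHo, ⟨e, h0⟩, fun hs => mem_irrefl H ((hH H).2 ⟨hHo, fun _ => hs⟩),
    fun b hb => ((hH b).1 hb).2⟩

/-- If `a` were equinumerous with some `b < a`, then `b` would be nonempty and `X` would map onto
`b`, hence onto `a`. -/
theorem IsH.isCard {a X : M} (h : IsH a X) : IsCard a := by
  obtain ⟨ha, ⟨y, hy⟩, hn, hs⟩ := h
  refine ⟨ha, fun b hb ⟨g, hg⟩ => hn ?_⟩
  obtain ⟨hg, gs⟩ := isSurj_iff.1 (isBij_iff.1 hg).1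
  obtain ⟨z, hz, -⟩ := gs y hy
  obtain ⟨f, hf⟩ := hs b hb ⟨z, hz⟩
  refine exists_isSurj (f := fun x => ap g (ap f x)) (by fun_prop) hy fun c hc => ?_
  obtain ⟨d, hd, rfl⟩ := gs c hc
  obtain ⟨x, hx, rfl⟩ := (isSurj_iff.1 hf).2 d hd
  exact ⟨x, hx, rfl⟩

/-! ### The partition theorems -/

/-- The greedy sequence with parameter `i` enumerates the fibre of `f` over `i` in increasing order.
Either some fibre is long enough, or indices below `κ` exhaust all fibres. -/
theorem arrowOne_of_isH {κ μ σ : M} (hκ : IsOrd κ) (hσ : IsH σ (prod μ κ)) :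
    ArrowOne σ κ μ := by
  intro f hf
  obtain ⟨hσo, ⟨y₀, hy₀⟩, hn, -⟩ := hσ
  by_contra hno
  refine hn ?_
  let A : M → M → Prop := fun i β => Mem β σ ∧ ap f β = i
  let R : M → M → M → Prop := fun _ β γ => Mem γ β
  have hA : DefP fun w : M × M => A w.1 w.2 := by simp only [A]; fun_prop
  have hR : DefP fun w : M × M × M => R w.1 w.2.1 w.2.2 := by simp only [R]; fun_prop
  have hd := fun {Γ : Type u} [Ctx M Γ] {f g : Γ → M} => DefF.greedy hA hR (f := f) (g := g)
  -- Decodes a pair `(i, ξ)` into the `ξ`-th element of fibre `i`; this is the candidate surjection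
  -- from `μ × κ`.
  let k : M → M := fun q => the fun β => ∃ i ξ, q = opr i ξ ∧ β = greedy A R i ξ
  have dk : DefF k := by fun_prop
  have hk : ∀ i ξ, k (opr i ξ) = greedy A R i ξ := fun i ξ => by
    refine the_eq fun z => ⟨?_, fun e => ⟨i, ξ, rfl, e⟩⟩
    rintro ⟨i', ξ', e, rfl⟩
    obtain ⟨rfl, rfl⟩ := opr_inj.1 e
    rfl
  refine exists_isSurj dk hy₀ fun b hb => ?_
  have hbo := hσo.mem hb
  have hAb : A (ap f b) b := ⟨hb, rfl⟩
  by_cases hex : ∃ ξ, Mem ξ κ ∧ ¬ Mem (greedy A R (ap f b) ξ) b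
  · obtain ⟨ξ, hξ, hm⟩ := hex
    obtain ⟨η, hη, e, -⟩ := greedy_hits hA hR hbo hAb (fun _ h => h) (hκ.mem hξ) hm
    have hηκ : Mem η κ := by
      rcases mem_succ.1 hη with h | rfl
      exacts [hκ.trans hξ h, hξ]
    exact ⟨opr (ap f b) η, mem_prod.2 ⟨_, hf.ap_mem hb, η, hηκ, rfl⟩, (hk _ _).trans e⟩
  · push Not at hex
    have hadm : ∀ ξ, Mem ξ κ → Adm A R (greedy A R) (ap f b) ξ (greedy A R (ap f b) ξ) :=
      fun ξ hξ => greedy_adm hA hR hbo hAb (fun _ h => h) (hκ.mem hξ)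
        fun ζ hζ => hex ζ (hκ.trans hξ hζ)
    have dg : DefF (greedy A R (ap f b)) := hd (DefF.const _) DefF.id
    have hsub : Sub (img κ (greedy A R (ap f b))) σ := fun z hz => by
      obtain ⟨ξ, hξ, rfl⟩ := (mem_img dg).1 hz
      exact (hadm ξ hξ).1.1
    refine absurd ⟨img κ (greedy A R (ap f b)), hsub, img_equinum dg fun x hx x' hx' e =>
      greedy_injOn hA hR hκ (fun _ _ h => h) hadm hx hx' e, ?_⟩ hno
    rw [constOn_iff hf hsub]
    intro x hx y hy
    obtain ⟨ξ, hξ, rfl⟩ := (mem_img dg).1 hx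
    obtain ⟨η, hη, rfl⟩ := (mem_img dg).1 hy
    rw [(hadm ξ hξ).1.2, (hadm η hη).1.2]

theorem exists_isSeqs {σ : M} (hσ : IsOrd σ) (μ : M) : ∃ S, IsSeqs S μ σ := by
  obtain ⟨S, hS⟩ := exists_sep (P := fun t => ∃ z, Mem z σ ∧ IsFun t z μ) (by fun_prop)
    (pow (prod σ μ))
  refine ⟨S, fun t => (hS t).trans (and_iff_right_of_imp fun ⟨z, hz, ht⟩ => ?_)⟩
  refine mem_pow.2 fun p hp => ?_
  obtain ⟨x, hx, y, hy, rfl⟩ := mem_prod.1 (ht.sub_prod p hp)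
  exact mem_prod.2 ⟨x, hσ.trans hz hx, y, hy, rfl⟩

/-- If no greedy end-homogeneous sequence has length `σ`, then each `α < l` is determined by the
colours along the greedy sequence that leads to it, so that `μ^{<σ}` maps onto `l`. -/
theorem arrowTwo_of_isH {κ μ σ S l : M} (hσ : IsCard σ) (h1 : ArrowOne σ κ μ)
    (hS : IsSeqs S μ σ) (hl : IsH l S) : ArrowTwo l κ μ := by
  refine ⟨pairs l, isPairs_iff.2 rfl, fun c hc => ?_⟩
  obtain ⟨hlo, ⟨y₀, hy₀⟩, hn, -⟩ := hl
  replace hσ := hσ.1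
  let A : M → M → Prop := fun _ β => Mem β l
  let R : M → M → M → Prop := fun α β γ => Mem γ β ∧ ap c (pr γ β) = ap c (pr γ α)
  have hA : DefP fun w : M × M => A w.1 w.2 := by simp only [A]; fun_prop
  have hR : DefP fun w : M × M × M => R w.1 w.2.1 w.2.2 := by simp only [R]; fun_prop
  have hd := fun {Γ : Type u} [Ctx M Γ] {f g : Γ → M} => DefF.greedy hA hR (f := f) (g := g)
  have hRa : ∀ α γ, Mem γ α → R α α γ := fun α γ h => ⟨h, rfl⟩
  have hcol : ∀ α γ, Mem α l → Mem γ α → Mem (ap c (pr γ α)) μ := fun α γ hα hγ =>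
    hc.ap_mem (mem_pairs.2 ⟨γ, hlo.trans hα hγ, α, hα, fun e => mem_irrefl _ (e ▸ hγ), rfl⟩)
  by_cases hlong : ∃ α, Mem α l ∧ ∀ ξ, Mem ξ σ → Mem (greedy A R α ξ) α
  -- The sequence for `α` is end-homogeneous of length `σ`; the exponent 1 relation is applied to
  -- its colours against `α`.
  · obtain ⟨α, hα, hlong⟩ := hlong
    have hadm : ∀ ξ, Mem ξ σ → Adm A R (greedy A R) α ξ (greedy A R α ξ) := fun ξ hξ =>
      greedy_adm hA hR (hlo.mem hα) hα (hRa α) (hσ.mem hξ) fun ζ hζ => hlong ζ (hσ.trans hξ hζ)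
    have dg : DefF (greedy A R α) := hd (DefF.const _) DefF.id
    have dt : DefF fun η => ap c (pr (greedy A R α η) α) := by fun_prop
    have hft := isFun_lam (a := σ) (b := μ) dt fun ξ hξ => hcol α _ hα (hlong ξ hξ)
    obtain ⟨H, hH, hHκ, hconst⟩ := h1 _ hft
    rw [constOn_iff hft hH] at hconst
    have hsub : Sub (img H (greedy A R α)) l := fun z hz => by
      obtain ⟨ξ, hξ, rfl⟩ := (mem_img dg).1 hz
      exact hlo.trans hα (hlong ξ (hH ξ hξ))
    refine ⟨img H (greedy A R α), hsub, (img_equinum dg fun x hx x' hx' e =>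
      greedy_injOn hA hR hσ (fun _ _ h => h.1) hadm (hH x hx) (hH x' hx') e).trans hHκ,
      pairs _, isPairs_iff.2 rfl, ?_⟩
    have hsub' : Sub (pairs (img H (greedy A R α))) (pairs l) := fun z hz => by
      obtain ⟨x, hx, y, hy, hxy, rfl⟩ := mem_pairs.1 hz
      exact mem_pairs.2 ⟨x, hsub x hx, y, hsub y hy, hxy, rfl⟩
    rw [constOn_iff hc hsub']
    -- The colour of a pair of terms is that of its earlier term with `α`, so it is a value of the
    -- thinned colouring.
    have key : ∀ z, Mem z (pairs (img H (greedy A R α))) →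
        ∃ η, Mem η H ∧ ap c z = ap (lam σ fun η => ap c (pr (greedy A R α η) α)) η := by
      intro z hz
      obtain ⟨x, hx, y, hy, hxy, rfl⟩ := mem_pairs.1 hz
      obtain ⟨ξ, hξ, rfl⟩ := (mem_img dg).1 hx
      obtain ⟨η, hη, rfl⟩ := (mem_img dg).1 hy
      rcases ord_trichotomy (hσ.mem (hH ξ hξ)) (hσ.mem (hH η hη)) with h | rfl | h
      · refine ⟨ξ, hξ, ?_⟩
        rw [ap_lam dt (hH ξ hξ)]
        exact ((hadm η (hH η hη)).2 ξ h).2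
      · exact absurd rfl hxy
      · refine ⟨η, hη, ?_⟩
        rw [ap_lam dt (hH η hη), pr_comm]
        exact ((hadm ξ (hH ξ hξ)).2 η h).2
    intro x hx y hy
    obtain ⟨ξ, hξ, ex⟩ := key x hx
    obtain ⟨η, hη, ey⟩ := key y hy
    rw [ex, ey, hconst ξ hξ η hη]
  · push Not at hlong
    exfalso
    let len : M → M := fun α => leastOrd fun ξ => greedy A R α ξ = α
    have dlen : DefF len := by fun_prop
    let T : M → M := fun α => lam (len α) fun η => ap c (pr (greedy A R α η) α)
    have dT : DefF T := by fun_prop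
    have dcol : ∀ α, DefF fun η => ap c (pr (greedy A R α η) α) := fun α => by fun_prop
    have hlen : ∀ α, Mem α l → Mem (len α) σ ∧ greedy A R α (len α) = α ∧
        ∀ ζ, Mem ζ (len α) → Mem (greedy A R α ζ) α := by
      intro α hα
      obtain ⟨ξ, hξ, hm⟩ := hlong α hα
      obtain ⟨η, hη, e, hlow⟩ := greedy_hits hA hR (hlo.mem hα) hα (hRa α) (hσ.mem hξ) hm
      have hησ : Mem η σ := by
        rcases mem_succ.1 hη with h | rfl
        exacts [hσ.trans hξ h, hξ]
      have : len α = η := leastOrd_eq (hσ.mem hησ) e fun ζ hζ e' =>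
        mem_irrefl α (by simpa only [e'] using hlow ζ hζ)
      rw [this]
      exact ⟨hησ, e, hlow⟩
    have hTS : ∀ α, Mem α l → Mem (T α) S := fun α hα =>
      (hS _).2 ⟨len α, (hlen α hα).1, isFun_lam (dcol α) fun η hη =>
        hcol α _ hα ((hlen α hα).2.2 η hη)⟩
    have hTinj : ∀ α, Mem α l → ∀ α', Mem α' l → T α = T α' → α = α' := by
      intro α hα α' hα' e
      obtain ⟨hσ1, e1, hlow1⟩ := hlen α hα
      obtain ⟨-, e2, -⟩ := hlen α' hα'
      have happ : ∀ η y, (Mem η (len α) ∧ y = ap c (pr (greedy A R α η) α)) ↔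
          (Mem η (len α') ∧ y = ap c (pr (greedy A R α' η) α')) := fun η y => by
        rw [← app_lam (dcol α), ← app_lam (dcol α')]
        exact iff_of_eq (congrArg (fun t => App t η y) e)
      have hll : len α = len α' := mem_ext fun η =>
        ⟨fun h => ((happ η _).1 ⟨h, rfl⟩).1, fun h => ((happ η _).2 ⟨h, rfl⟩).1⟩
      have hcc : ∀ η, Mem η (len α) →
          ap c (pr (greedy A R α η) α) = ap c (pr (greedy A R α' η) α') :=
        fun η h => ((happ η _).1 ⟨h, rfl⟩).2
      have hlo1 : IsOrd (len α) := hσ.mem hσ1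
      -- Given the earlier terms, the next one depends on `α` only through the colours, which agree.
      -- The range includes the index `len α`, where the two sequences take the values `α` and `α'`.
      have main : ∀ η, IsOrd η → Mem η (succ (len α)) → greedy A R α η = greedy A R α' η := by
        intro η hη
        refine ord_induction (P := fun η => Mem η (succ (len α)) →
          greedy A R α η = greedy A R α' η) (DefP.imp (by fun_prop) (by fun_prop)) ?_ hη
        intro η hη ih hm
        rw [greedy_eq hA hR hη, greedy_eq hA hR hη]
        refine congrArg leastOrd (funext fun β => propext (and_congr_right fun _ =>
          forall₂_congr fun ζ hζ => ?_))
        have hζl : Mem ζ (len α) := by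
          rcases mem_succ.1 hm with h | rfl
          exacts [hlo1.trans h hζ, hζ]
        have h := ih ζ hζ (mem_succ.2 (Or.inl hζl))
        change (_ ∧ _ = ap c (pr (greedy A R α ζ) α)) ↔ (_ ∧ _ = ap c (pr (greedy A R α' ζ) α'))
        rw [hcc ζ hζl, h]
      have h := main _ hlo1 (mem_succ.2 (Or.inr rfl))
      rw [e1, hll, e2] at h
      exact h
    -- The inverse of the injection `T`, with junk values off its range, is the forbidden
    -- surjection.
    refine hn (exists_isSurj (f := fun t => the fun α => Mem α l ∧ T α = t) (by fun_prop) hy₀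
      fun α hα => ⟨T α, hTS α hα, the_eq fun z => ⟨fun ⟨hz, e⟩ => hTinj z hz α hα e, ?_⟩⟩)
    rintro rfl
    exact ⟨hα, rfl⟩

end

end ZFSetTheory

/-! ### Assembly in an arbitrary model of ZF -/

theorem mainTheorem8 : ZFSetTheory.ZF ⊨ᵇ ZFSetTheory.erdosRado := by
  refine Theory.models_sentence_iff.2 fun M => ZFSetTheory.realize_erdosRado.2 fun κ μ hκ _ => ?_
  have hone : ∃ σ : M, ZFSetTheory.IsCard σ ∧ ZFSetTheory.ArrowOne σ κ μ := by
    obtain ⟨σ, hσ⟩ := ZFSetTheory.exists_isH (ZFSetTheory.prod μ κ)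
    exact ⟨σ, hσ.isCard, ZFSetTheory.arrowOne_of_isH hκ.1 hσ⟩
  have htwo : ∀ σ : M, ZFSetTheory.IsCard σ → ZFSetTheory.ArrowOne σ κ μ →
      ∃ S, ZFSetTheory.IsSeqs S μ σ ∧ ∃ l, ZFSetTheory.IsH l S ∧ ZFSetTheory.IsCard l ∧
        ZFSetTheory.ArrowTwo l κ μ := by
    intro σ hσ h1
    obtain ⟨S, hS⟩ := ZFSetTheory.exists_isSeqs hσ.1 μ
    obtain ⟨l, hl⟩ := ZFSetTheory.exists_isH S
    exact ⟨S, hS, l, hl, hl.isCard, ZFSetTheory.arrowTwo_of_isH hσ h1 hS hl⟩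
  refine ⟨?_, hone, htwo⟩
  obtain ⟨σ, hσ, h1⟩ := hone
  obtain ⟨_, _, l, _, hl, h2⟩ := htwo σ hσ h1
  exact ⟨l, hl, h2⟩
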